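/- Let $(\mathcal M,\rho)$ be a pseudometric space, where $\rho:\mathcal M\times\mathcal M\to[0,+\infty]$ is symmetric, vanishes on the diagonal, satisfies the triangle inequality, and may take the value $+\infty$. Let $n:\mathcal M\to\mathbb R^2$ be a mapping with $\|n(x)\|_{\ell_2^2}=1$ for all $x$, let $\alpha:\mathcal M\to\mathbb R$, and for $x\in\mathcal M$ let $F(x)=\{a\in\mathbb R^2:\langle a,n(x)\rangle+\alpha(x)\le 0\}$, a closed half-plane with boundary line $\ell_F(x)$. Assume that for every $x\in\mathcal M$ either the set $\{y\in\mathcal M:\rho(x,y)<\infty\}$ is finite or it contains finitely many elements $x_1,\dots,x_m$ such that the interior of the convex hull of $n(x_1),\dots,n(x_m)$ contains $0$. (This holds in particular if $\mathcal M$ is finite, and also if $\rho$ is finite-valued and there are $x_1,\dots,x_m\in\mathcal M$ such that the interior of the convex hull of $n(x_1),\dots,n(x_m)$ contains $0$.) Notation: $\ell_\infty^2$ is $\mathbb R^2$ with the norm $\|a\|=\max\{|a_1|,|a_2|\}$. For non-empty $A,B\subset\mathbb R^2$, $\operatorname{dist}(A,B)=\inf\{\|a-b\|:a\in A,\ b\in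 B\}$ in this norm, and $\operatorname{dist}(A,B)=0$ if $A$ or $B$ is empty. $\varphi_F(x,y)\in[0,\pi/2]$ is the smallest angle between the lines $\ell_F(x)$ and $\ell_F(y)$ (equal to $0$ if they are parallel). $\operatorname{diam}_\rho$ is the diameter with respect to $\rho$. We set $0/0=0$ and $a/0=+\infty$ for $a\in(0,+\infty]$. A Lipschitz selection of $F$ is a mapping $f:\mathcal M\to\ell_\infty^2$ with $f(x)\in F(x)$ for all $x$ whose Lipschitz seminorm $\|f\|_{\mathrm{Lip}}=\inf\{K>0:\|f(x)-f(y)\|\le K\rho(x,y)\ \text{for all } x,y\in\mathcal M\}$ is finite; $|F|$ is the infimum of $\|f\|_{\mathrm{Lip}}$ over all Lipschitz selections $f$ of $F$. Infima over the empty set are $+\infty$. Then $F$ has a Lipschitz selection if and only if there is a constant $\lambda>0$ such that for all $x,x',y,y'\in\mathcal M$ $$\operatorname{dist}\bigl(F(x)\cap F(x'),\,F(y)\cap F(y')\bigr)\le\lambda\left\{\frac{\rho(x,x')}{\sin\varphi_F(x,x')}+\frac{\rho(y,y')}{\sin\varphi_F(y,y')}+\operatorname{diam}_\rho\{x,x',y,y'\}\right\}.$$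 Furthermore, if $\inf\lambda$ denotes the infimum of the constants $\lambda>0$ with this property, then $$\tfrac1{\sqrt2}\,\inf\lambda\le|F|\le\gamma\,\inf\lambda,$$ where $\gamma>0$ is an absolute constant (independent of $\mathcal M,\rho,n,\alpha$) with $\gamma\le5\cdot10^5$. -/

import Mathlib

open scoped NNReal ENNReal

noncomputable section

namespace HalfPlaneSelection

/-- The closed half-plane `{a : ⟨a, n⟩ + α ≤ 0}` with outer normal `n`.  The plane is `Fin 2 → ℝ`,
which carries the uniform norm `ℓ∞²`; the normal is a vector of the Euclidean plane. -/
def halfPlane (n : EuclideanSpace ℝ (Fin 2)) (α : ℝ) : Set (Fin 2 → ℝ) :=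
  {a | a 0 * n 0 + a 1 * n 1 + α ≤ 0}

/-- A direction vector of the boundary line `{a : ⟨a, n⟩ + α = 0}` of a half-plane with
normal `n`. -/
def boundaryDirection (n : EuclideanSpace ℝ (Fin 2)) : EuclideanSpace ℝ (Fin 2) :=
  !₂[-n 1, n 0]

/-- The (smallest) angle, in `[0, π/2]`, between two straight lines with nonzero direction vectors
`u` and `v`; it is `0` when the lines are parallel. -/
def lineAngle (u v : EuclideanSpace ℝ (Fin 2)) : ℝ :=
  min (InnerProductGeometry.angle u v) (Real.pi - InnerProductGeometry.angle u v)

/-- The angle between the boundaries of two half-planes with normals `n` and `n'`. -/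
def boundaryAngle (n n' : EuclideanSpace ℝ (Fin 2)) : ℝ :=
  lineAngle (boundaryDirection n) (boundaryDirection n')

open Classical in
/-- The distance `inf {‖a - b‖ : a ∈ A, b ∈ B}` in the norm of `ℓ∞²`, with the convention that it
is `0` when one of the sets is empty. -/
def setDist (A B : Set (Fin 2 → ℝ)) : ℝ≥0∞ :=
  if A.Nonempty ∧ B.Nonempty then ⨅ a ∈ A, ⨅ b ∈ B, edist a b else 0

variable {M : Type*} [PseudoEMetricSpace M]

/-- The Lipschitz seminorm: the infimum of all `K > 0` with `‖f x - f y‖ ≤ K ρ(x, y)`. -/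
def lipSeminorm (f : M → Fin 2 → ℝ) : ℝ≥0∞ :=
  ⨅ (K : ℝ≥0) (_ : 0 < K ∧ LipschitzWith K f), (K : ℝ≥0∞)

/-- `f` is a Lipschitz selection of the set-valued mapping `F`. -/
def IsLipschitzSelection (F : M → Set (Fin 2 → ℝ)) (f : M → Fin 2 → ℝ) : Prop :=
  (∀ x, f x ∈ F x) ∧ ∃ K : ℝ≥0, LipschitzWith K f

/-- `|F|`: the infimum of the Lipschitz seminorms of the Lipschitz selections of `F`
(`∞` if there are none). -/
def selectionNorm (F : M → Set (Fin 2 → ℝ)) : ℝ≥0∞ :=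
  ⨅ (f : M → Fin 2 → ℝ) (_ : IsLipschitzSelection F f), lipSeminorm f

/-- The four-point inequality with constant `l` for the mapping `x ↦ halfPlane (n x) (α x)`.
Division in `ℝ≥0∞` follows the conventions `0 / 0 = 0` and `a / 0 = ∞` for `a > 0`. -/
def FourPointCondition (n : M → EuclideanSpace ℝ (Fin 2)) (α : M → ℝ) (l : ℝ≥0) : Prop :=
  ∀ x x' y y' : M,
    setDist (halfPlane (n x) (α x) ∩ halfPlane (n x') (α x'))
        (halfPlane (n y) (α y) ∩ halfPlane (n y') (α y')) ≤
      (l : ℝ≥0∞) *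
        (edist x x' / ENNReal.ofReal (Real.sin (boundaryAngle (n x) (n x'))) +
          edist y y' / ENNReal.ofReal (Real.sin (boundaryAngle (n y) (n y'))) +
          Metric.ediam {x, x', y, y'})

/-- The infimum of all `l > 0` for which the four-point inequality holds (`∞` if there are none). -/
def fourPointInf (n : M → EuclideanSpace ℝ (Fin 2)) (α : M → ℝ) : ℝ≥0∞ :=
  ⨅ (l : ℝ≥0) (_ : 0 < l ∧ FourPointCondition n α l), (l : ℝ≥0∞)

end HalfPlaneSelection

end

/-! Necessity. A point of `F x` within `δ` of a point of `F x'` violates `F x'` by at most `√2 * δ`,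
since a Euclidean unit vector has ℓ¹ norm at most `√2`. Sliding parallel to the boundary of `F x`
repairs this at the cost of a division by the sine (`exists_mem_inter_near`).

Sufficiency. By duality the four-point inequality becomes a lower bound for nonnegative combinations
of the right-hand sides `b` whose normals cancel (`PlanarSystem`). For finitely many points at
finite distances, attach to each `x` all the half-planes `F y`, each relaxed by `72 * l * d x y`;
the half-plane of `x` itself is not relaxed at `x`. Pairs of relaxed half-planes bound the
coordinates, and `height_pairs` shows that upper bounds at `x` and lower bounds at `z` are
compatible up to `72 * l * d x z`. McShane's formula then gives Lipschitz functions `P` and `Q`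
obeying these bounds. The point `(P x, Q x)` may still violate relaxed half-planes, but only those
with normals in one open quadrant, and a diagonal shift by the largest violation repairs them
without creating a new one: a violated normal outside the quadrant would span with one inside it a
cone containing a coordinate vector, or be opposite to it, against the bounds (`quadrant_false`).
The shift is Lipschitz as well.

The heart is `opposite_pairs`, a bound for a four-term relation free of sines. The four-point
inequality alone is too weak when the sines are small. A three-term relation, whose bound `circuit`
involves no sines, is subtracted until either a weight vanishes, leaving another three-term
relation, or the vector shared by the two pairs is short enough to cancel the sines.

Compactness extends the result to infinite sets of points with finite mutual distances, and sets at
infinite distance from each other are treated independently. -/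

open scoped NNReal ENNReal

/-! ### Dual form of the four-point inequality; three-term relations between normals. -/

/-- Finitely many half-planes `{a | p i * a 0 + q i * a 1 ≤ b i}` with Euclidean unit normals,
indexed by the points of a pseudometric space with distance `d`, which satisfy the dual form `four`
of the four-point inequality with constant `l`. -/
structure PlanarSystem (ι : Type*) where
  d : ι → ι → ℝ
  p : ι → ℝ
  q : ι → ℝ
  b : ι → ℝ
  l : ℝ
  d_self : ∀ i, d i i = 0
  d_comm : ∀ i j, d i j = d j i
  d_triangle : ∀ i j k, d i k ≤ d i j + d j k
  l_nonneg : 0 ≤ l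
  unit : ∀ i, p i ^ 2 + q i ^ 2 = 1
  -- The disjunctions make both intersections non-empty, so the convention for empty sets plays no
  -- role, and a zero determinant occurs only over `d i i = 0`. `V` bounds the ℓ¹ norm, which is
  -- dual to the uniform norm; the last sum of distances majorizes the diameter.
  four : ∀ i j k m, (p i * q j - q i * p j ≠ 0 ∨ i = j) → (p k * q m - q k * p m ≠ 0 ∨ k = m) →
    ∀ ci cj ck cm v w V : ℝ, 0 ≤ ci → 0 ≤ cj → 0 ≤ ck → 0 ≤ cm →
      ci * p i + cj * p j = v → ci * q i + cj * q j = w →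
      ck * p k + cm * p m = -v → ck * q k + cm * q m = -w → |v| + |w| ≤ V →
      -(l * (V * (d i j / |p i * q j - q i * p j| + d k m / |p k * q m - q k * p m|
        + (d i j + d i k + d k m)))) ≤ ci * b i + cj * b j + ck * b k + cm * b m

namespace PlanarSystem

variable {ι : Type*} (S : PlanarSystem ι)

lemma d_nonneg (i j : ι) : 0 ≤ S.d i j := by
  have := S.d_triangle i j i
  rw [S.d_self, S.d_comm j i] at this
  linarith

/-- The determinant of the normals of two half-planes. -/
def det (i j : ι) : ℝ := S.p i * S.q j - S.q i * S.p j

/-- The system with interchanged coordinates. -/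
def swap : PlanarSystem ι where
  d := S.d
  p := S.q
  q := S.p
  b := S.b
  l := S.l
  d_self := S.d_self
  d_comm := S.d_comm
  d_triangle := S.d_triangle
  l_nonneg := S.l_nonneg
  unit i := by rw [add_comm]; exact S.unit i
  four i j k m hij hkm ci cj ck cm v w V h1 h2 h3 h4 e1 e2 e3 e4 hV := by
    have aux : ∀ i j, S.q i * S.p j - S.p i * S.q j = -(S.p i * S.q j - S.q i * S.p j) :=
      fun i j => by ring
    rw [aux, neg_ne_zero] at hij hkm
    rw [aux i j, aux k m, abs_neg, abs_neg]
    exact S.four i j k m hij hkm ci cj ck cm w v V h1 h2 h3 h4 e2 e1 e4 e3 (by linarith)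

/-- The system reflected in the second coordinate axis. -/
def reflect : PlanarSystem ι where
  d := S.d
  p := fun i => -S.p i
  q := S.q
  b := S.b
  l := S.l
  d_self := S.d_self
  d_comm := S.d_comm
  d_triangle := S.d_triangle
  l_nonneg := S.l_nonneg
  unit i := by rw [neg_sq]; exact S.unit i
  four i j k m hij hkm ci cj ck cm v w V h1 h2 h3 h4 e1 e2 e3 e4 hV := by
    have aux : ∀ i j, -S.p i * S.q j - S.q i * -S.p j = -(S.p i * S.q j - S.q i * S.p j) :=
      fun i j => by ring
    rw [aux, neg_ne_zero] at hij hkm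
    rw [aux i j, aux k m, abs_neg, abs_neg]
    exact S.four i j k m hij hkm ci cj ck cm (-v) w V h1 h2 h3 h4 (by linarith) e2 (by linarith) e4
      (by rwa [abs_neg])

lemma abs_p_le (i : ι) : |S.p i| ≤ 1 := by
  rw [abs_le_one_iff_mul_self_le_one]; nlinarith [S.unit i, sq_nonneg (S.q i)]

lemma abs_q_le (i : ι) : |S.q i| ≤ 1 := S.swap.abs_p_le i

lemma abs_det_le (i j : ι) : |S.det i j| ≤ 1 := by
  rw [abs_le_one_iff_mul_self_le_one]
  have h : S.det i j * S.det i j + (S.p i * S.p j + S.q i * S.q j) ^ 2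
      = (S.p i ^ 2 + S.q i ^ 2) * (S.p j ^ 2 + S.q j ^ 2) := by unfold det; ring
  rw [S.unit, S.unit] at h
  nlinarith [sq_nonneg (S.p i * S.p j + S.q i * S.q j)]

/-- The four-point inequality for two half-planes with opposite normals. -/
lemma opposite {i j : ι} (hp : S.p j = -S.p i) (hq : S.q j = -S.q i) :
    -(2 * S.l * S.d i j) ≤ S.b i + S.b j := by
  have h := S.four i i j j (Or.inr rfl) (Or.inr rfl) 1 0 1 0 (S.p i) (S.q i) 2 one_pos.le le_rfl
    one_pos.le le_rfl (by ring) (by ring) (by rw [hp]; ring) (by rw [hq]; ring)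
    (by linarith [S.abs_p_le i, S.abs_q_le i])
  rw [S.d_self, S.d_self] at h
  simp only [zero_div] at h
  linarith

/-- For `t > 0` the unit normals are collinear with nonpositive inner product, hence opposite, and
`opposite` applies. This is the degenerate case of `circuit_max`. -/
lemma circuit_edge {i j : ι} {t : ℝ} (ht : 0 ≤ t) (hc : t * (S.p i * S.p j + S.q i * S.q j) ≤ 0)
    (hD : t * S.det i j = 0) :
    t * (S.p i * S.p j + S.q i * S.q j) = -t ∧
      -(2 * S.l * (t * S.d i j)) ≤ t * (S.b i + S.b j) := by
  rcases ht.eq_or_lt with rfl | ht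
  · simp
  have hD0 : S.det i j = 0 := (mul_eq_zero.1 hD).resolve_left ht.ne'
  have hc0 : S.p i * S.p j + S.q i * S.q j ≤ 0 := by
    by_contra! h; nlinarith [mul_pos ht h]
  have h : S.det i j ^ 2 + (S.p i * S.p j + S.q i * S.q j) ^ 2
      = (S.p i ^ 2 + S.q i ^ 2) * (S.p j ^ 2 + S.q j ^ 2) := by unfold det; ring
  rw [S.unit, S.unit, hD0] at h
  have hc1 : S.p i * S.p j + S.q i * S.q j = -1 := by nlinarith
  have h2 : (S.p i + S.p j) ^ 2 + (S.q i + S.q j) ^ 2 = 0 := by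
    have := S.unit i; have := S.unit j; nlinarith
  have hp : S.p j = -S.p i := by nlinarith [sq_nonneg (S.p i + S.p j), sq_nonneg (S.q i + S.q j)]
  have hq : S.q j = -S.q i := by nlinarith [sq_nonneg (S.p i + S.p j), sq_nonneg (S.q i + S.q j)]
  refine ⟨by rw [hc1]; ring, ?_⟩
  have := mul_le_mul_of_nonneg_left (S.opposite hp hq) ht.le
  linarith

/-- The inequality for three positively dependent normals, centred at the one of largest weight. -/
lemma circuit_max {i j k : ι} {t u v : ℝ} (hu : 0 ≤ u) (hv : 0 ≤ v) (hut : u ≤ t) (hvt : v ≤ t)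
    (hp : t * S.p i + u * S.p j + v * S.p k = 0) (hq : t * S.q i + u * S.q j + v * S.q k = 0) :
    -(4 * S.l * (u * S.d i j + v * S.d i k)) ≤ t * S.b i + u * S.b j + v * S.b k := by
  set c := S.p i * S.p j + S.q i * S.q j with hc
  set e := S.p i * S.p k + S.q i * S.q k with he
  have ui := S.unit i
  have uj := S.unit j
  have uk := S.unit k
  have hl := S.l_nonneg
  have hdj := S.d_nonneg i j
  have hdk := S.d_nonneg i k
  have hdot : t = -(u * c) + -(v * e) := by
    have : t * (S.p i ^ 2 + S.q i ^ 2) + u * c + v * e = 0 := by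
      rw [hc, he]; linear_combination S.p i * hp + S.q i * hq
    rw [ui] at this; linarith
  have hcross : u * S.det i j + v * S.det i k = 0 := by
    unfold det; linear_combination S.p i * hq - S.q i * hp
  -- Law of cosines: `v² = t² + u² + 2t(u cos)` with `v ≤ t` excludes an acute angle at the heaviest
  -- normal.
  have key : ∀ (j k : ι) (u v : ℝ), 0 ≤ u → 0 ≤ v → v ≤ t → t * S.p i + u * S.p j + v * S.p k = 0 →
      t * S.q i + u * S.q j + v * S.q k = 0 → u * (S.p i * S.p j + S.q i * S.q j) ≤ 0 := by
    intro j k u v hu hv hvt hp hq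
    have h : v ^ 2 * (S.p k ^ 2 + S.q k ^ 2) = t ^ 2 * (S.p i ^ 2 + S.q i ^ 2)
        + u ^ 2 * (S.p j ^ 2 + S.q j ^ 2) + 2 * t * (u * (S.p i * S.p j + S.q i * S.q j)) := by
      have h1 : v * S.p k = -(t * S.p i + u * S.p j) := by linarith
      have h2 : v * S.q k = -(t * S.q i + u * S.q j) := by linarith
      calc _ = (v * S.p k) ^ 2 + (v * S.q k) ^ 2 := by ring
        _ = _ := by rw [h1, h2]; ring
    rw [S.unit, S.unit, S.unit] at h
    by_contra! hcon
    have ht : 0 ≤ t := hv.trans hvt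
    have := mul_nonneg ht hcon.le
    have hu0 : u = 0 := by nlinarith
    rw [hu0] at hcon
    simp at hcon
  have hc0 : u * c ≤ 0 := key j k u v hu hv hvt hp hq
  have he0 : v * e ≤ 0 := key k j v u hv hu hut (by linarith) (by linarith)
  by_cases hD : u * S.det i j = 0
  · obtain ⟨h1, h2⟩ := S.circuit_edge hu hc0 hD
    obtain ⟨h3, h4⟩ := S.circuit_edge hv he0 (by linarith)
    rw [← hc] at h1
    rw [← he] at h3
    have ht : t = u + v := by linarith
    have := mul_nonneg hl (mul_nonneg hu hdj)
    have := mul_nonneg hl (mul_nonneg hv hdk)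
    rw [ht]; linarith
  have hD' : v * S.det i k ≠ 0 := fun h => hD (by linarith)
  have hDj : S.det i j ≠ 0 := right_ne_zero_of_mul hD
  have hDk : S.det i k ≠ 0 := right_ne_zero_of_mul hD'
  have habs : u * |S.det i j| = v * |S.det i k| := by
    have := congrArg abs (eq_neg_of_add_eq_zero_left hcross)
    rwa [abs_neg, abs_mul, abs_mul, abs_of_nonneg hu, abs_of_nonneg hv] at this
  -- The weight `t` of the `i`-th normal is split by `hdot` so that each pair retains only the
  -- component of its other normal orthogonal to the `i`-th one. These components are opposite, of
  -- Euclidean length `u * |det i j| = v * |det i k|`, and this factor cancels the sines.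
  have h := S.four i j i k (Or.inl hDj) (Or.inl hDk) (-(u * c)) u (-(v * e)) v
    (-(u * S.det i j * S.q i)) (u * S.det i j * S.p i) (2 * (u * |S.det i j|))
    (by linarith) hu (by linarith) hv
    (by unfold det; rw [hc]; linear_combination (-(u * S.p j)) * ui)
    (by unfold det; rw [hc]; linear_combination (-(u * S.q j)) * ui)
    (by rw [show -(-(u * S.det i j * S.q i)) = -(v * S.det i k) * S.q i by
          linear_combination S.q i * hcross]
        unfold det; rw [he]; linear_combination (-(v * S.p k)) * ui)
    (by rw [show -(u * S.det i j * S.p i) = (v * S.det i k) * S.p i by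
          linear_combination -S.p i * hcross]
        unfold det; rw [he]; linear_combination (-(v * S.q k)) * ui)
    (by rw [abs_neg, abs_mul, abs_mul _ (S.p i), abs_mul u, abs_of_nonneg hu]
        have := mul_nonneg hu (abs_nonneg (S.det i j))
        nlinarith [S.abs_p_le i, S.abs_q_le i])
  have e1 : u * |S.det i j| * (S.d i j / |S.det i j|) = u * S.d i j := by
    field_simp [abs_pos.2 hDj]
  have e2 : u * |S.det i j| * (S.d i k / |S.det i k|) = v * S.d i k := by
    rw [habs]; field_simp [abs_pos.2 hDk]
  have e3 : u * |S.det i j| * S.d i j ≤ u * S.d i j :=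
    mul_le_mul_of_nonneg_right (mul_le_of_le_one_right hu (S.abs_det_le i j)) hdj
  have e4 : u * |S.det i j| * S.d i k ≤ v * S.d i k := by
    rw [habs]
    exact mul_le_mul_of_nonneg_right (mul_le_of_le_one_right hv (S.abs_det_le i k)) hdk
  rw [S.d_self] at h
  change -(S.l * (2 * (u * |S.det i j|) * (S.d i j / |S.det i j| + S.d i k / |S.det i k|
    + (S.d i j + 0 + S.d i k)))) ≤ _ at h
  have h5 : S.l * (2 * (u * |S.det i j|) * (S.d i j / |S.det i j| + S.d i k / |S.det i k|
    + (S.d i j + 0 + S.d i k))) ≤ S.l * (4 * (u * S.d i j + v * S.d i k)) :=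
    mul_le_mul_of_nonneg_left (by linarith) hl
  have h6 : t * S.b i = -(u * c) * S.b i + -(v * e) * S.b i := by rw [← add_mul, ← hdot]
  linarith

/-- Moves the base point from `i` to any `x`: as `t` is the largest weight, the triangle inequality
costs only a factor 2, turning 4 into 8. -/
lemma circuit_aux (x : ι) {i j k : ι} {t u v : ℝ} (hu : 0 ≤ u) (hv : 0 ≤ v) (hut : u ≤ t)
    (hvt : v ≤ t)
    (hp : t * S.p i + u * S.p j + v * S.p k = 0) (hq : t * S.q i + u * S.q j + v * S.q k = 0) :
    -(8 * S.l * (t * S.d x i + u * S.d x j + v * S.d x k))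
      ≤ t * S.b i + u * S.b j + v * S.b k := by
  refine le_trans ?_ (S.circuit_max hu hv hut hvt hp hq)
  have h1 := mul_le_mul_of_nonneg_left (S.d_triangle i x j) hu
  have h2 := mul_le_mul_of_nonneg_left (S.d_triangle i x k) hv
  rw [S.d_comm i x] at h1 h2
  have h3 := mul_le_mul_of_nonneg_right hut (S.d_nonneg x i)
  have h4 := mul_le_mul_of_nonneg_right hvt (S.d_nonneg x i)
  have h5 := mul_nonneg hu (S.d_nonneg x j)
  have h6 := mul_nonneg hv (S.d_nonneg x k)
  have : S.l * (4 * (u * S.d i j + v * S.d i k)) ≤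
      S.l * (8 * (t * S.d x i + u * S.d x j + v * S.d x k)) :=
    mul_le_mul_of_nonneg_left (by linarith) S.l_nonneg
  linarith

/-- The inequality for three positively dependent normals. -/
lemma circuit (x : ι) {i j k : ι} {t u v : ℝ} (ht : 0 ≤ t) (hu : 0 ≤ u) (hv : 0 ≤ v)
    (hp : t * S.p i + u * S.p j + v * S.p k = 0) (hq : t * S.q i + u * S.q j + v * S.q k = 0) :
    -(8 * S.l * (t * S.d x i + u * S.d x j + v * S.d x k))
      ≤ t * S.b i + u * S.b j + v * S.b k := by
  by_cases h1 : u ≤ t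
  · by_cases h2 : v ≤ t
    · exact S.circuit_aux x hu hv h1 h2 hp hq
    · have := S.circuit_aux x (i := k) (j := i) (k := j) (t := v) (u := t) (v := u) ht hu
        (by linarith) (by linarith) (by linarith) (by linarith)
      linarith
  · by_cases h2 : v ≤ u
    · have := S.circuit_aux x (i := j) (j := i) (k := k) (t := u) (u := t) (v := v) ht hv
        (by linarith) (by linarith) (by linarith) (by linarith)
      linarith
    · have := S.circuit_aux x (i := k) (j := i) (k := j) (t := v) (u := t) (v := u) ht hu
        (by linarith) (by linarith) (by linarith) (by linarith)
      linarith

end PlanarSystem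

/-! ### Four-term relations: two cones containing opposite basis vectors. -/

/-- Moving from a nonnegative vector in the direction `-c` until a coordinate vanishes, but for a
time at most `1`. -/
lemma exists_first_exit {a₁ a₂ a₃ : ℝ} (h₁ : 0 ≤ a₁) (h₂ : 0 ≤ a₂) (h₃ : 0 ≤ a₃) (c₁ c₂ c₃ : ℝ) :
    ∃ τ : ℝ, 0 ≤ τ ∧ τ ≤ 1 ∧ 0 ≤ a₁ - τ * c₁ ∧ 0 ≤ a₂ - τ * c₂ ∧ 0 ≤ a₃ - τ * c₃ ∧
      (τ = 1 ∨ a₁ - τ * c₁ = 0 ∨ a₂ - τ * c₂ = 0 ∨ a₃ - τ * c₃ = 0) := by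
  have key : ∀ a c : ℝ, 0 ≤ a → ∃ τ : ℝ, 0 ≤ τ ∧ τ ≤ 1 ∧ (τ = 1 ∨ a - τ * c = 0) ∧
      ∀ σ : ℝ, 0 ≤ σ → σ ≤ τ → 0 ≤ a - σ * c := by
    intro a c ha
    by_cases hc : c ≤ a
    · refine ⟨1, zero_le_one, le_rfl, Or.inl rfl, fun σ h0 h1 => ?_⟩
      rcases le_total c 0 with h | h <;> nlinarith
    · push Not at hc
      have hc0 : 0 < c := ha.trans_lt hc
      refine ⟨a / c, by positivity, (div_le_one hc0).2 hc.le, Or.inr (by field_simp; ring),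
        fun σ _ h1 => ?_⟩
      have := (le_div_iff₀ hc0).1 h1
      linarith
  obtain ⟨x, x0, x1, hx, hx'⟩ := key a₁ c₁ h₁
  obtain ⟨y, y0, y1, hy, hy'⟩ := key a₂ c₂ h₂
  obtain ⟨z, z0, z1, hz, hz'⟩ := key a₃ c₃ h₃
  have m0 : 0 ≤ min x (min y z) := le_min x0 (le_min y0 z0)
  refine ⟨min x (min y z), m0, (min_le_left _ _).trans x1, hx' _ m0 (min_le_left _ _),
    hy' _ m0 ((min_le_right _ _).trans (min_le_left _ _)),
    hz' _ m0 ((min_le_right _ _).trans (min_le_right _ _)), ?_⟩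
  rcases min_choice x (min y z) with h | h
  · rw [h]; tauto
  · rcases min_choice y z with h' | h' <;> rw [h, h'] <;> tauto

namespace PlanarSystem

variable {ι : Type*} (S : PlanarSystem ι)

/-- Law of cosines: `t² = 1 - 2 s p_i + s²`, and `t ≤ s`. -/
lemma half_le {i j : ι} {s t : ℝ} (ht : 0 ≤ t) (hts : t ≤ s)
    (hp : s * S.p i + t * S.p j = 1) (hq : s * S.q i + t * S.q j = 0) : 1 / 2 ≤ s * S.p i := by
  have h : t ^ 2 * (S.p j ^ 2 + S.q j ^ 2)
      = 1 - 2 * (s * S.p i) + s ^ 2 * (S.p i ^ 2 + S.q i ^ 2) := by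
    have h1 : t * S.p j = 1 - s * S.p i := by linarith
    have h2 : t * S.q j = -(s * S.q i) := by linarith
    calc _ = (t * S.p j) ^ 2 + (t * S.q j) ^ 2 := by ring
      _ = _ := by rw [h1, h2]; ring
  rw [S.unit, S.unit] at h
  nlinarith

lemma eq_one_of_axis {i : ι} {s : ℝ} (hs : 0 ≤ s) (hp : s * S.p i = 1) (hq : s * S.q i = 0) :
    s = 1 ∧ S.p i = 1 ∧ S.q i = 0 := by
  have hs0 : s ≠ 0 := by rintro rfl; simp at hp
  have hq0 : S.q i = 0 := (mul_eq_zero.1 hq).resolve_left hs0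
  have hu := S.unit i
  have hp0 : 0 ≤ S.p i := by
    by_contra! h; nlinarith
  have hp1 : S.p i = 1 := by
    rw [hq0] at hu; nlinarith
  exact ⟨by rw [hp1] at hp; linarith, hp1, hq0⟩

/-- The coefficients of a multiple of the first basis vector of length `‖e₁ - τ n‖ ≤ 2`. -/
lemma weight_le_two {i j : ι} {w τ : ℝ} (h0 : 0 ≤ τ) (h1 : τ ≤ 1)
    (hp : w * S.p j = -(1 - τ * S.p i)) (hq : w * S.q j = τ * S.q i) : w ≤ 2 := by
  have h : w ^ 2 * (S.p j ^ 2 + S.q j ^ 2)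
      = 1 - 2 * (τ * S.p i) + τ ^ 2 * (S.p i ^ 2 + S.q i ^ 2) := by
    calc _ = (w * S.p j) ^ 2 + (w * S.q j) ^ 2 := by ring
      _ = _ := by rw [hp, hq]; ring
  rw [S.unit, S.unit] at h
  have := (abs_le.1 (S.abs_p_le i)).1
  by_contra! hw
  nlinarith

set_option maxHeartbeats 1000000 in
-- The negative of the `i`-th normal lies in the cone of the `k`-th and `m`-th ones. The resulting
-- three-term relation is subtracted from the four-term relation for a time `τ ≤ 1`, and each way of
-- stopping leaves a relation that can be estimated.
lemma opposite_pairs_aux {i j k m : ι} {s t u v : ℝ} (ht : 0 < t) (hts : t ≤ s) (hv : 0 < v)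
    (hvu : v ≤ u) (hij : S.det i j ≠ 0) (hkm : S.det k m ≠ 0)
    (hp : s * S.p i + t * S.p j = 1) (hq : s * S.q i + t * S.q j = 0)
    (hp' : u * S.p k + v * S.p m = -1) (hq' : u * S.q k + v * S.q m = 0)
    (hqq : |S.q i| ≤ |S.q k|) :
    -(24 * S.l * (t * S.d i j + v * S.d k m + S.d i k))
      ≤ s * S.b i + t * S.b j + u * S.b k + v * S.b m := by
  have hs : 0 < s := ht.trans_le hts
  have hu : 0 < u := hv.trans_le hvu
  have hsp : 1 / 2 ≤ s * S.p i := S.half_le ht.le hts hp hq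
  have hup : 1 / 2 ≤ u * -S.p k :=
    S.reflect.half_le hv.le hvu (by simp only [reflect]; linarith) hq'
  have hpi : 0 < S.p i := by by_contra! h; nlinarith
  have hpk : 0 < -S.p k := by by_contra! h; nlinarith
  have hqi : S.q i = -(t * S.det i j) := by unfold det; linear_combination S.p i * hq - S.q i * hp
  have hqk : S.q k = v * S.det k m := by
    unfold det; linear_combination S.q k * hp' - S.p k * hq'
  have hqk0 : S.q k ≠ 0 := by rw [hqk]; exact mul_ne_zero hv.ne' hkm
  have ui := S.unit i
  have uk := S.unit k
  have hpp : -S.p k ≤ S.p i := by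
    have := sq_le_sq.2 hqq
    nlinarith
  -- With these `r` and `K`, the `i`-th normal is `r` times the `k`-th plus `K e₁`. Replacing `-e₁`
  -- by the second pair gives the three-term relation with weights `1`, `c = K u - r`, `K v`.
  obtain ⟨r, hr⟩ : ∃ r, r = S.q i / S.q k := ⟨_, rfl⟩
  have hrq : r * S.q k = S.q i := by rw [hr]; field_simp
  have hr1 : |r| ≤ 1 := by
    rw [hr, abs_div]; exact (div_le_one (abs_pos.2 hqk0)).2 hqq
  obtain ⟨r0, r1⟩ := abs_le.1 hr1
  obtain ⟨K, hK⟩ : ∃ K, K = S.p i - r * S.p k := ⟨_, rfl⟩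
  have hK0 : 0 ≤ K := by nlinarith
  have hpi1 := (abs_le.1 (S.abs_p_le i)).2
  have hpk1 := (abs_le.1 (S.abs_p_le k)).1
  have hK2 : K ≤ 2 := by nlinarith
  obtain ⟨c, hc⟩ : ∃ c, c = K * u - r := ⟨_, rfl⟩
  -- For `r ≥ 0`, `K ≥ (1 + r)(-p_k)` and `u(-p_k) ≥ 1/2` give `K u ≥ (1 + r)/2 ≥ r`.
  have hc0 : 0 ≤ c := by
    rcases le_total r 0 with h | h
    · nlinarith [mul_nonneg hK0 hu.le]
    · have h1 : (1 + r) * -S.p k ≤ K := by nlinarith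
      have h2 := mul_le_mul_of_nonneg_right h1 hu.le
      have h3 := mul_le_mul_of_nonneg_left hup (by linarith : 0 ≤ 1 + r)
      linarith
  have cp : 1 * S.p i + c * S.p k + K * v * S.p m = 0 := by
    rw [hc]; linear_combination K * hp' - hK
  have cq : 1 * S.q i + c * S.q k + K * v * S.q m = 0 := by
    rw [hc]; linear_combination K * hq' - hrq
  have hl := S.l_nonneg
  have hC := S.circuit k one_pos.le hc0 (mul_nonneg hK0 hv.le) cp cq
  rw [S.d_self, S.d_comm k i] at hC
  have dij := S.d_nonneg i j
  have dkm := S.d_nonneg k m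
  have dik := S.d_nonneg i k
  have tdij := mul_nonneg ht.le dij
  have vdkm := mul_nonneg hv.le dkm
  obtain ⟨τ, τ0, τ1, g1, g2, g3, hτ⟩ := exists_first_exit hs.le hu.le hv.le 1 c (K * v)
  have hC' := mul_le_mul_of_nonneg_left hC τ0
  have hC1 : -(8 * S.l * (S.d i k + 2 * (v * S.d k m)))
      ≤ τ * (1 * S.b i + c * S.b k + K * v * S.b m) := by
    refine le_trans ?_ hC'
    have h1 : K * (v * S.d k m) ≤ 2 * (v * S.d k m) := mul_le_mul_of_nonneg_right hK2 vdkm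
    have h2 : τ * (S.d i k + K * (v * S.d k m)) ≤ S.d i k + K * (v * S.d k m) :=
      mul_le_of_le_one_left (by positivity) τ1
    have h3 := mul_le_mul_of_nonneg_left (h2.trans (add_le_add le_rfl h1)) hl
    linarith
  have vec1 : (s - τ * 1) * S.p i + t * S.p j = 1 - τ * S.p i := by linarith
  have vec2 : (s - τ * 1) * S.q i + t * S.q j = -(τ * S.q i) := by linarith
  have vec3 : (u - τ * c) * S.p k + (v - τ * (K * v)) * S.p m = -(1 - τ * S.p i) := by
    linear_combination hp' - τ * cp
  have vec4 : (u - τ * c) * S.q k + (v - τ * (K * v)) * S.q m = τ * S.q i := by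
    linear_combination hq' - τ * cq
  suffices h : -(16 * S.l * (t * S.d i j + v * S.d k m + S.d i k) - 8 * S.l * (v * S.d k m))
      ≤ (s - τ * 1) * S.b i + t * S.b j + (u - τ * c) * S.b k + (v - τ * (K * v)) * S.b m by
    have := mul_nonneg hl tdij
    have := mul_nonneg hl vdkm
    have := mul_nonneg hl dik
    linarith
  have finish : ∀ B X : ℝ, -(8 * S.l * X) ≤ B →
      X ≤ 2 * (t * S.d i j) + v * S.d k m + 2 * S.d i k →
      -(16 * S.l * (t * S.d i j + v * S.d k m + S.d i k) - 8 * S.l * (v * S.d k m)) ≤ B := by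
    intro B X h1 h2
    have := mul_le_mul_of_nonneg_left h2 hl
    linarith
  rcases hτ with h | h | h | h
  · subst h
    have hq1 : |S.q i| = t * |S.det i j| := by rw [hqi, abs_neg, abs_mul, abs_of_pos ht]
    have hq2 : |S.q k| = v * |S.det k m| := by rw [hqk, abs_mul, abs_of_pos hv]
    -- At `τ = 1` the vector shared by the pairs is `e₁` minus the `i`-th normal, and `1 - p_i ≤ 1 -
    -- p_i² = q_i² ≤ |q_i|`. Since `|q_i| = t |det i j|` and `|q_i| ≤ |q_k| = v |det k m|`, both
    -- sines cancel.
    have hV : |1 - 1 * S.p i| + |-(1 * S.q i)| ≤ 2 * |S.q i| := by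
      rw [one_mul, one_mul, abs_neg, abs_of_nonneg (by linarith)]
      have h2 : S.p i ^ 2 + |S.q i| ^ 2 = 1 := by rw [sq_abs]; exact ui
      have h3 := abs_nonneg (S.q i)
      have h4 : S.p i ^ 2 ≤ S.p i := by rw [sq]; exact mul_le_of_le_one_left hpi.le hpi1
      have h5 : |S.q i| ^ 2 ≤ |S.q i| := by rw [sq]; exact mul_le_of_le_one_left h3 (S.abs_q_le i)
      linarith
    have hP := S.four i j k m (Or.inl hij) (Or.inl hkm) _ _ _ _ _ _ _ g1 ht.le g2 g3 vec1 vec2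
      vec3 (by rw [vec4]; ring) hV
    change -(S.l * (2 * |S.q i| * (S.d i j / |S.det i j| + S.d k m / |S.det k m|
      + (S.d i j + S.d i k + S.d k m)))) ≤ _ at hP
    have b1 : |S.q i| * (S.d i j / |S.det i j|) = t * S.d i j := by
      rw [hq1]; field_simp [abs_pos.2 hij]
    have b2 : |S.q i| * (S.d k m / |S.det k m|) ≤ v * S.d k m := by
      have : |S.q k| * (S.d k m / |S.det k m|) = v * S.d k m := by
        rw [hq2]; field_simp [abs_pos.2 hkm]
      rw [← this]
      exact mul_le_mul_of_nonneg_right hqq (by positivity)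
    have b3 : |S.q i| * S.d i j ≤ t * S.d i j := by
      rw [hq1]
      exact mul_le_mul_of_nonneg_right (mul_le_of_le_one_right ht.le (S.abs_det_le i j)) dij
    have b4 : |S.q i| * S.d k m ≤ v * S.d k m := by
      refine (mul_le_mul_of_nonneg_right hqq dkm).trans ?_
      rw [hq2]
      exact mul_le_mul_of_nonneg_right (mul_le_of_le_one_right hv.le (S.abs_det_le k m)) dkm
    have b5 : |S.q i| * S.d i k ≤ S.d i k := mul_le_of_le_one_left dik (S.abs_q_le i)
    refine finish _ (2 * |S.q i| * (S.d i j / |S.det i j| + S.d k m / |S.det k m|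
      + (S.d i j + S.d i k + S.d k m)) / 8) (by linarith) ?_
    linarith
  -- The `i`-th normal has dropped out. Here `s = τ ≤ 1`, so `t ≤ 1` and `t * d k i` is harmless.
  · rw [h] at vec1 vec2 ⊢
    have hC2 := S.circuit k ht.le g2 g3 (i := j) (j := k) (k := m) (by linarith) (by linarith)
    refine finish _ _ (hC2.trans (by linarith)) ?_
    rw [S.d_self]
    have h1 := mul_le_mul_of_nonneg_left (S.d_triangle k i j) ht.le
    have h2 : t * S.d k i ≤ S.d k i := mul_le_of_le_one_left (S.d_nonneg _ _) (by linarith)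
    have h3 : (v - τ * (K * v)) * S.d k m ≤ v * S.d k m :=
      mul_le_mul_of_nonneg_right (sub_le_self _ (mul_nonneg τ0 (mul_nonneg hK0 hv.le))) dkm
    rw [S.d_comm k i] at h1 h2
    linarith
  · rw [h] at vec3 vec4 ⊢
    have hw : v - τ * (K * v) ≤ 2 := S.weight_le_two (i := i) (j := m) τ0 τ1 (by linarith) (by linarith)
    have hC2 := S.circuit i g1 ht.le g3 (i := i) (j := j) (k := m) (by linarith) (by linarith)
    refine finish _ _ (hC2.trans (by linarith)) ?_
    rw [S.d_self]
    have h1 := mul_le_mul_of_nonneg_left (S.d_triangle i k m) g3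
    have h2 := mul_le_mul_of_nonneg_right hw dik
    have h3 : (v - τ * (K * v)) * S.d k m ≤ v * S.d k m :=
      mul_le_mul_of_nonneg_right (sub_le_self _ (mul_nonneg τ0 (mul_nonneg hK0 hv.le))) dkm
    linarith
  · rw [h] at vec3 vec4 ⊢
    have hw : u - τ * c ≤ 2 := S.weight_le_two (i := i) (j := k) τ0 τ1 (by linarith) (by linarith)
    have hC2 := S.circuit i g1 ht.le g2 (i := i) (j := j) (k := k) (by linarith) (by linarith)
    refine finish _ _ (hC2.trans (by linarith)) ?_
    rw [S.d_self]
    have h2 := mul_le_mul_of_nonneg_right hw dik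
    linarith

/-- The inequality for two pairs of normals whose cones contain opposite basis vectors, when the
first weight of each pair is the larger one. -/
lemma opposite_pairs {i j k m : ι} {s t u v : ℝ} (ht : 0 ≤ t) (hts : t ≤ s) (hv : 0 ≤ v)
    (hvu : v ≤ u) (hij : S.det i j ≠ 0 ∨ t = 0) (hkm : S.det k m ≠ 0 ∨ v = 0)
    (hp : s * S.p i + t * S.p j = 1) (hq : s * S.q i + t * S.q j = 0)
    (hp' : u * S.p k + v * S.p m = -1) (hq' : u * S.q k + v * S.q m = 0) :
    -(24 * S.l * (t * S.d i j + v * S.d k m + S.d i k))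
      ≤ s * S.b i + t * S.b j + u * S.b k + v * S.b m := by
  have hs : 0 ≤ s := ht.trans hts
  have hu : 0 ≤ u := hv.trans hvu
  have hl := S.l_nonneg
  have tdij := mul_nonneg hl (mul_nonneg ht (S.d_nonneg i j))
  have vdkm := mul_nonneg hl (mul_nonneg hv (S.d_nonneg k m))
  have dik := mul_nonneg hl (S.d_nonneg i k)
  rcases ht.eq_or_lt with rfl | ht'
  · obtain ⟨rfl, -, -⟩ := S.eq_one_of_axis hs (by linarith) (by linarith : s * S.q i = 0)
    have := S.circuit k hs hu hv (i := i) (j := k) (k := m) (by linarith) (by linarith)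
    rw [S.d_self, S.d_comm k i] at this
    linarith
  rcases hv.eq_or_lt with rfl | hv'
  · obtain ⟨rfl, -, -⟩ := S.reflect.eq_one_of_axis (i := k) hu
      (by simp only [reflect]; linarith) (by simp only [reflect]; linarith)
    have := S.circuit i hs ht hu (i := i) (j := j) (k := k) (by linarith) (by linarith)
    rw [S.d_self] at this
    linarith
  have hij' := hij.resolve_right ht'.ne'
  have hkm' := hkm.resolve_right hv'.ne'
  rcases le_total |S.q i| |S.q k| with h | h
  · exact S.opposite_pairs_aux ht' hts hv' hvu hij' hkm' hp hq hp' hq' h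
  · have aux : ∀ i j, S.reflect.det i j = -S.det i j := fun i j => by
      simp only [reflect, det]; ring
    have := S.reflect.opposite_pairs_aux (i := k) (j := m) (k := i) (m := j) hv' hvu ht' hts
      (by rw [aux]; exact neg_ne_zero.2 hkm') (by rw [aux]; exact neg_ne_zero.2 hij')
      (by simp only [reflect]; linarith) hq' (by simp only [reflect]; linarith) hq h
    simp only [reflect] at this
    rw [S.d_comm k i] at this
    linarith

/-! ### Relaxed half-planes and compatibility of the coordinate bounds. -/

/-- The dual description of the half-plane with index `y`, enlarged in proportion to the distance
from `x`. -/
def height (x y : ι) : ℝ := S.b y + 72 * S.l * S.d x y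

lemma height_opposite (x : ι) {i j : ι} (hp : S.p j = -S.p i) (hq : S.q j = -S.q i) :
    0 ≤ S.height x i + S.height x j := by
  have h := S.opposite hp hq
  have h1 := mul_le_mul_of_nonneg_left (S.d_triangle i x j) S.l_nonneg
  have h2 := mul_nonneg S.l_nonneg (S.d_nonneg i x)
  have h3 := mul_nonneg S.l_nonneg (S.d_nonneg x j)
  unfold height
  rw [S.d_comm x i]
  linarith

/-- The leading weights `s` and `u` are at least `1/2`, so the unweighted `d i k` is at most `2s d x
i + d x z + 2u d z k`. Together with the weighted distances within the pairs this costs a factor 3,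
whence `72 = 3 * 24`. -/
lemma height_pairs_aux (x z : ι) {i j k m : ι} {s t u v : ℝ} (ht : 0 ≤ t) (hts : t ≤ s)
    (hv : 0 ≤ v) (hvu : v ≤ u) (hij : S.det i j ≠ 0 ∨ t = 0) (hkm : S.det k m ≠ 0 ∨ v = 0)
    (hp : s * S.p i + t * S.p j = 1) (hq : s * S.q i + t * S.q j = 0)
    (hp' : u * S.p k + v * S.p m = -1) (hq' : u * S.q k + v * S.q m = 0) :
    0 ≤ s * S.height x i + t * S.height x j + (u * S.height z k + v * S.height z m)
      + 72 * S.l * S.d x z := by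
  have h := S.opposite_pairs ht hts hv hvu hij hkm hp hq hp' hq'
  have hs : 0 ≤ s := ht.trans hts
  have hu : 0 ≤ u := hv.trans hvu
  have hs2 : 1 / 2 ≤ s := by
    have := S.half_le ht hts hp hq
    have := mul_le_mul_of_nonneg_left (abs_le.1 (S.abs_p_le i)).2 hs
    linarith
  have hu2 : 1 / 2 ≤ u := by
    have : 1 / 2 ≤ u * -S.p k :=
      S.reflect.half_le hv hvu (by simp only [reflect]; linarith) hq'
    have := mul_le_mul_of_nonneg_left (abs_le.1 (S.abs_p_le k)).1 hu
    linarith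
  have e1 := mul_le_mul_of_nonneg_left (S.d_triangle i x j) ht
  have e2 := mul_le_mul_of_nonneg_left (S.d_triangle k z m) hv
  have e3 := S.d_triangle i x k
  have e4 := S.d_triangle x z k
  rw [S.d_comm i x] at e1 e3
  rw [S.d_comm k z] at e2
  have e5 := mul_le_mul_of_nonneg_right hts (S.d_nonneg x i)
  have e6 := mul_le_mul_of_nonneg_right hvu (S.d_nonneg z k)
  have e7 := mul_le_mul_of_nonneg_right hs2 (S.d_nonneg x i)
  have e8 := mul_le_mul_of_nonneg_right hu2 (S.d_nonneg z k)
  have f1 := mul_nonneg ht (S.d_nonneg x j)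
  have f2 := mul_nonneg hv (S.d_nonneg z m)
  have f3 := S.d_nonneg x z
  have key : S.l * (t * S.d i j + v * S.d k m + S.d i k) ≤ S.l * (3 * (s * S.d x i + t * S.d x j
      + u * S.d z k + v * S.d z m + S.d x z)) :=
    mul_le_mul_of_nonneg_left (by linarith) S.l_nonneg
  unfold height
  linarith

/-- Upper and lower bounds for the first coordinate, coming from pairs of half-planes, are
compatible. -/
lemma height_pairs (x z : ι) {i j k m : ι} {s t u v : ℝ} (hs : 0 ≤ s) (ht : 0 ≤ t) (hu : 0 ≤ u)
    (hv : 0 ≤ v) (hij : S.det i j ≠ 0 ∨ t = 0) (hkm : S.det k m ≠ 0 ∨ v = 0)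
    (hp : s * S.p i + t * S.p j = 1) (hq : s * S.q i + t * S.q j = 0)
    (hp' : u * S.p k + v * S.p m = -1) (hq' : u * S.q k + v * S.q m = 0) :
    0 ≤ s * S.height x i + t * S.height x j + (u * S.height z k + v * S.height z m)
      + 72 * S.l * S.d x z := by
  have aux : ∀ i j, S.det i j = -S.det j i := fun i j => by unfold det; ring
  have aux2 : ∀ {i j : ι} {s t : ℝ}, 0 ≤ s → ¬ t ≤ s → S.det i j ≠ 0 ∨ t = 0 →
      S.det j i ≠ 0 ∨ s = 0 := by
    intro i j s t hs hts h
    rcases h with h | h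
    · left; rw [aux, neg_ne_zero]; exact h
    · exact absurd (h.le.trans hs) hts
  by_cases h1 : t ≤ s
  · by_cases h2 : v ≤ u
    · exact S.height_pairs_aux x z ht h1 hv h2 hij hkm hp hq hp' hq'
    · have := S.height_pairs_aux x z ht h1 hu (not_le.1 h2).le hij (aux2 hu h2 hkm) hp hq
        ((add_comm _ _).trans hp') ((add_comm _ _).trans hq')
      linarith
  · by_cases h2 : v ≤ u
    · have := S.height_pairs_aux x z hs (not_le.1 h1).le hv h2 (aux2 hs h1 hij) hkm
        ((add_comm _ _).trans hp) ((add_comm _ _).trans hq) hp' hq'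
      linarith
    · have := S.height_pairs_aux x z hs (not_le.1 h1).le hu (not_le.1 h2).le (aux2 hs h1 hij)
        (aux2 hu h2 hkm) ((add_comm _ _).trans hp) ((add_comm _ _).trans hq)
        ((add_comm _ _).trans hp') ((add_comm _ _).trans hq')
      linarith

end PlanarSystem

/-! ### Incompatible violations at a point within the coordinate bounds. -/

/-- Two half-planes that are violated at `(P - v, Q - v)` and whose normals do not both lie in the
open first quadrant are incompatible with upper bounds for the coordinates by `P` and `Q`. -/
lemma quadrant_false {a b c d P Q X Y v : ℝ} (ha : 0 < a) (hb : 0 < b) (hu : a ^ 2 + b ^ 2 = 1)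
    (hu' : c ^ 2 + d ^ 2 = 1) (hv : 0 ≤ v) (hX : X ≤ a * P + b * Q - v * (a + b))
    (hY : Y < c * (P - v) + d * (Q - v)) (hcd : ¬ (0 < c ∧ 0 < d))
    (h₁ : ∀ s t : ℝ, 0 ≤ s → 0 ≤ t → a * d - b * c ≠ 0 → s * b + t * d = 0 → s * a + t * c = 1 →
      P ≤ s * X + t * Y)
    (h₂ : ∀ s t : ℝ, 0 ≤ s → 0 ≤ t → a * d - b * c ≠ 0 → s * a + t * c = 0 → s * b + t * d = 1 →
      Q ≤ s * X + t * Y)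
    (h₀ : c = -a → d = -b → 0 ≤ X + Y) : False := by
  have combine : ∀ s t : ℝ, 0 ≤ s → 0 < t →
      s * X + t * Y < (s * a + t * c) * (P - v) + (s * b + t * d) * (Q - v) := by
    intro s t hs ht
    have e1 := mul_le_mul_of_nonneg_left hX hs
    have e2 := mul_lt_mul_of_pos_left hY ht
    linarith
  -- For negative determinant the cone of the two normals contains `e₁`, for positive determinant
  -- `e₂`; Cramer's rule gives the weights. The combined half-planes then contradict the bound for
  -- that coordinate.
  rcases lt_trichotomy (a * d - b * c) 0 with hD | hD | hD
  · have hd : d ≤ 0 := by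
      by_contra! h
      have hc : 0 < c := by
        by_contra! h'
        have := mul_pos ha h
        have := mul_nonneg hb.le (neg_nonneg.2 h')
        linarith
      exact hcd ⟨hc, h⟩
    have e1 : d / (a * d - b * c) * b + -b / (a * d - b * c) * d = 0 := by field_simp; ring
    have e2 : d / (a * d - b * c) * a + -b / (a * d - b * c) * c = 1 := by
      rw [div_mul_eq_mul_div, div_mul_eq_mul_div, ← add_div, div_eq_one_iff_eq hD.ne]; ring
    have hs : 0 ≤ d / (a * d - b * c) := div_nonneg_of_nonpos hd hD.le
    have ht : 0 < -b / (a * d - b * c) := div_pos_of_neg_of_neg (by linarith) hD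
    have := h₁ _ _ hs ht.le hD.ne e1 e2
    have := combine _ _ hs ht
    rw [e1, e2] at this
    linarith
  · have h : (a * c + b * d) ^ 2 = 1 := by
      have : (a * c + b * d) ^ 2 + (a * d - b * c) ^ 2 = (a ^ 2 + b ^ 2) * (c ^ 2 + d ^ 2) := by
        ring
      rw [hu, hu', hD] at this
      linarith
    rcases sq_eq_one_iff.1 h with h | h
    · have : (a - c) ^ 2 + (b - d) ^ 2 = 0 := by linarith
      have h1 : c = a := by nlinarith [sq_nonneg (a - c), sq_nonneg (b - d)]
      have h2 : d = b := by nlinarith [sq_nonneg (a - c), sq_nonneg (b - d)]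
      exact hcd ⟨h1 ▸ ha, h2 ▸ hb⟩
    · have : (a + c) ^ 2 + (b + d) ^ 2 = 0 := by linarith
      have h1 : c = -a := by nlinarith [sq_nonneg (a + c), sq_nonneg (b + d)]
      have h2 : d = -b := by nlinarith [sq_nonneg (a + c), sq_nonneg (b + d)]
      have := h₀ h1 h2
      have := combine 1 1 zero_le_one one_pos
      rw [h1, h2] at this
      linarith
  · have hc : c ≤ 0 := by
      by_contra! h
      have hd : 0 < d := by
        by_contra! h'
        have := mul_pos hb h
        have := mul_nonneg ha.le (neg_nonneg.2 h')
        linarith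
      exact hcd ⟨h, hd⟩
    have e1 : -c / (a * d - b * c) * a + a / (a * d - b * c) * c = 0 := by field_simp; ring
    have e2 : -c / (a * d - b * c) * b + a / (a * d - b * c) * d = 1 := by
      rw [div_mul_eq_mul_div, div_mul_eq_mul_div, ← add_div, div_eq_one_iff_eq hD.ne']; ring
    have hs : 0 ≤ -c / (a * d - b * c) := div_nonneg (by linarith) hD.le
    have ht : 0 < a / (a * d - b * c) := div_pos ha hD
    have := h₂ _ _ hs ht.le hD.ne' e1 e2
    have := combine _ _ hs ht
    rw [e1, e2] at this
    linarith

/-! ### Lipschitz choice of the two coordinates. -/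

namespace PlanarSystem

variable {ι : Type*} (S : PlanarSystem ι)

/-- Lipschitz functions between compatible upper and lower bounds. -/
lemma exists_lipschitz_between {L : ℝ} (hL : 0 ≤ L) {A B : Set (ι × ℝ)} (hA : A.Finite)
    (hB : B.Finite) (h : ∀ u ∈ A, ∀ v ∈ B, v.2 ≤ u.2 + L * S.d u.1 v.1) :
    ∃ φ : ι → ℝ, (∀ x y, φ x ≤ φ y + L * S.d x y) ∧ (∀ u ∈ A, φ u.1 ≤ u.2) ∧
      ∀ v ∈ B, v.2 ≤ φ v.1 := by
  rcases A.eq_empty_or_nonempty with rfl | ⟨u₀, hu₀⟩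
  · obtain ⟨c, hc⟩ := (hB.image Prod.snd).bddAbove
    refine ⟨fun _ => c, fun x y => ?_, by simp, fun v hv => hc (Set.mem_image_of_mem _ hv)⟩
    have := mul_nonneg hL (S.d_nonneg x y)
    linarith
  · have : Nonempty A := ⟨⟨u₀, hu₀⟩⟩
    have : Finite A := hA
    have bdd : ∀ x, BddBelow (Set.range fun u : A => u.1.2 + L * S.d x u.1.1) :=
      fun x => (Set.finite_range _).bddBelow
    refine ⟨fun x => ⨅ u : A, (u.1.2 + L * S.d x u.1.1), fun x y => ?_, fun u hu => ?_,
      fun v hv => ?_⟩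
    · rw [← sub_le_iff_le_add]
      refine le_ciInf fun u => ?_
      have h1 := ciInf_le (bdd x) u
      have h2 := mul_le_mul_of_nonneg_left (S.d_triangle x y u.1.1) hL
      linarith
    · have := ciInf_le (bdd u.1) ⟨u, hu⟩
      rwa [S.d_self, mul_zero, add_zero] at this
    · refine le_ciInf fun u => ?_
      rw [S.d_comm]
      exact h _ u.2 _ hv

/-- The weights are determined by `i`, `j` and `e`, through Cramer's rule or from a single normal on
the axis; the Boolean records which. Finiteness makes McShane's formula meaningful over the reals.
-/
lemma finite_bounds [Finite ι] {e : ℝ} (he : e ≠ 0) (g : ℝ → ℝ) :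
    {u : ι × ℝ | ∃ i j s t, 0 ≤ s ∧ 0 ≤ t ∧ (S.det i j ≠ 0 ∨ t = 0) ∧
      s * S.p i + t * S.p j = e ∧ s * S.q i + t * S.q j = 0 ∧
      u.2 = g (s * S.height u.1 i + t * S.height u.1 j)}.Finite := by
  classical
  refine Set.Finite.subset (Set.finite_range fun w : ι × ι × ι × Bool =>
    (w.1, g (if w.2.2.2 then
      e * S.q w.2.2.1 / S.det w.2.1 w.2.2.1 * S.height w.1 w.2.1
        + -e * S.q w.2.1 / S.det w.2.1 w.2.2.1 * S.height w.1 w.2.2.1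
      else e / S.p w.2.1 * S.height w.1 w.2.1))) ?_
  rintro ⟨x, r⟩ ⟨i, j, s, t, hs, ht, hD, hp, hq, hr⟩
  rcases hD with hD | rfl
  · refine ⟨(x, i, j, true), ?_⟩
    have e1 : s = e * S.q j / S.det i j := by
      rw [eq_div_iff hD]; unfold det; linear_combination S.q j * hp - S.p j * hq
    have e2 : t = -e * S.q i / S.det i j := by
      rw [eq_div_iff hD]; unfold det; linear_combination S.p i * hq - S.q i * hp
    simp only [if_true, ← e1, ← e2]
    exact Prod.ext rfl hr.symm
  · refine ⟨(x, i, j, false), ?_⟩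
    have hs0 : s ≠ 0 := by rintro rfl; simp at hp; exact he hp.symm
    have hq0 : S.q i = 0 := by simpa [hs0] using hq
    have hp0 : S.p i ≠ 0 := by
      intro h; have := S.unit i; rw [h, hq0] at this; norm_num at this
    have e1 : s = e / S.p i := by rw [eq_div_iff hp0]; linarith
    simp only [Bool.false_eq_true, if_false, ← e1]
    exact Prod.ext rfl (by simp at hr ⊢; exact hr.symm)

/-- `P` satisfies the bounds for the first coordinate which follow from pairs of half-planes. -/
def Admissible (P : ι → ℝ) : Prop :=
  ∀ x i j (s t e : ℝ), 0 ≤ s → 0 ≤ t → (S.det i j ≠ 0 ∨ t = 0) → (e = 1 ∨ e = -1) →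
    s * S.p i + t * S.p j = e → s * S.q i + t * S.q j = 0 →
    e * P x ≤ s * S.height x i + t * S.height x j

/-- McShane's formula applied to the upper bounds (`e = 1`) and the negated ones (`e = -1`, lower
bounds); `height_pairs` is exactly the compatibility it needs. -/
lemma exists_admissible [Finite ι] :
    ∃ P : ι → ℝ, S.Admissible P ∧ ∀ x y, |P x - P y| ≤ 72 * S.l * S.d x y := by
  obtain ⟨P, h1, h2, h3⟩ := S.exists_lipschitz_between (L := 72 * S.l)
    (by linarith [S.l_nonneg]) (S.finite_bounds one_ne_zero id) (S.finite_bounds (neg_ne_zero.2 one_ne_zero) Neg.neg) (by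
      rintro ⟨x, a⟩ ⟨i, j, s, t, hs, ht, hD, hp, hq, ha⟩ ⟨z, c⟩
        ⟨k, m, u, v, hu, hv, hD', hp', hq', hc⟩
      simp only [id] at ha hc ⊢
      have := S.height_pairs x z hs ht hu hv hD hD' hp hq hp' hq'
      linarith)
  refine ⟨P, ?_, fun x y => ?_⟩
  · intro x i j s t e hs ht hD he hp hq
    rcases he with rfl | rfl
    · have := h2 (x, s * S.height x i + t * S.height x j) ⟨i, j, s, t, hs, ht, hD, hp, hq, rfl⟩
      simpa using this
    · have := h3 (x, -(s * S.height x i + t * S.height x j)) ⟨i, j, s, t, hs, ht, hD, hp, hq, rfl⟩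
      simp only at this
      linarith
  · have := h1 x y
    have := h1 y x
    rw [S.d_comm] at this
    rw [abs_le]; constructor <;> linarith

/-! ### Diagonal correction by the largest violation. -/

/-- The distance, in the uniform norm, by which the point `(P x, Q x)` violates the enlarged
half-plane with index `y`, if the normal lies in the quadrant given by the signs `e` and `f`. -/
noncomputable def excess (P Q : ι → ℝ) (e f : ℝ) (x y : ι) : ℝ :=
  if 0 < e * S.p y ∧ 0 < f * S.q y then
    max 0 ((S.p y * P x + S.q y * Q x - S.height x y) / (e * S.p y + f * S.q y)) else 0

/-- The largest violation by a half-plane whose normal lies in the quadrant given by the signs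
`e` and `f`. -/
noncomputable def maxExcess (P Q : ι → ℝ) (e f : ℝ) (x : ι) : ℝ := ⨆ y, S.excess P Q e f x y

lemma excess_nonneg (P Q : ι → ℝ) (e f : ℝ) (x y : ι) : 0 ≤ S.excess P Q e f x y := by
  unfold excess; split_ifs
  · exact le_max_left _ _
  · exact le_rfl

lemma maxExcess_nonneg (P Q : ι → ℝ) (e f : ℝ) (x : ι) : 0 ≤ S.maxExcess P Q e f x :=
  Real.iSup_nonneg fun y => S.excess_nonneg P Q e f x y

lemma excess_le_maxExcess [Finite ι] (P Q : ι → ℝ) (e f : ℝ) (x y : ι) :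
    S.excess P Q e f x y ≤ S.maxExcess P Q e f x :=
  le_ciSup (f := fun y => S.excess P Q e f x y) (Set.finite_range _).bddAbove y

/-- The numerator varies by at most `72 l d (|p| + |q|)` through `P` and `Q` and by `72 l d` through
`height`. As `|p| + |q| ≥ 1`, the quotient varies by at most `144 l d`. -/
lemma excess_le {P Q : ι → ℝ} (hP : ∀ x y, |P x - P y| ≤ 72 * S.l * S.d x y)
    (hQ : ∀ x y, |Q x - Q y| ≤ 72 * S.l * S.d x y) {e f : ℝ} (he : e = 1 ∨ e = -1)
    (hf : f = 1 ∨ f = -1) (x z y : ι) :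
    S.excess P Q e f x y ≤ S.excess P Q e f z y + 144 * S.l * S.d x z := by
  have hd : 0 ≤ S.l * S.d x z := mul_nonneg S.l_nonneg (S.d_nonneg x z)
  unfold excess
  split_ifs with h
  · obtain ⟨hp, hq⟩ := h
    have ep : e * S.p y = |S.p y| := by
      rw [← abs_of_pos hp, abs_mul]; rcases he with rfl | rfl <;> simp
    have eq : f * S.q y = |S.q y| := by
      rw [← abs_of_pos hq, abs_mul]; rcases hf with rfl | rfl <;> simp
    have h1 : 1 ≤ |S.p y| + |S.q y| := by
      have := S.unit y
      rw [← sq_abs (S.p y), ← sq_abs (S.q y)] at this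
      nlinarith [S.abs_p_le y, S.abs_q_le y, abs_nonneg (S.p y), abs_nonneg (S.q y)]
    have hpos : 0 < |S.p y| + |S.q y| := by linarith
    rw [ep, eq]
    refine max_le (add_nonneg (le_max_left _ _) (by linarith)) ?_
    rw [div_le_iff₀ hpos, add_mul]
    have h2 : S.p y * P z + S.q y * Q z - S.height z y ≤
        max 0 ((S.p y * P z + S.q y * Q z - S.height z y) / (|S.p y| + |S.q y|))
          * (|S.p y| + |S.q y|) := by
      rw [← div_le_iff₀ hpos]; exact le_max_right _ _
    have h3 : S.p y * (P x - P z) ≤ |S.p y| * (72 * S.l * S.d x z) :=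
      (le_abs_self _).trans
        (by rw [abs_mul]; exact mul_le_mul_of_nonneg_left (hP x z) (abs_nonneg _))
    have h4 : S.q y * (Q x - Q z) ≤ |S.q y| * (72 * S.l * S.d x z) :=
      (le_abs_self _).trans
        (by rw [abs_mul]; exact mul_le_mul_of_nonneg_left (hQ x z) (abs_nonneg _))
    have h5 : S.height z y ≤ S.height x y + 72 * (S.l * S.d x z) := by
      have := mul_le_mul_of_nonneg_left (S.d_triangle z x y) S.l_nonneg
      rw [S.d_comm z x] at this
      unfold height; linarith
    have h6 := mul_le_mul_of_nonneg_right h1 hd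
    linarith
  · linarith [hd]

lemma abs_maxExcess_sub_le [Finite ι] {P Q : ι → ℝ}
    (hP : ∀ x y, |P x - P y| ≤ 72 * S.l * S.d x y)
    (hQ : ∀ x y, |Q x - Q y| ≤ 72 * S.l * S.d x y) {e f : ℝ} (he : e = 1 ∨ e = -1)
    (hf : f = 1 ∨ f = -1) (x z : ι) :
    |S.maxExcess P Q e f x - S.maxExcess P Q e f z| ≤ 144 * S.l * S.d x z := by
  have key : ∀ x z, S.maxExcess P Q e f x ≤ S.maxExcess P Q e f z + 144 * S.l * S.d x z := by
    intro x z
    have : Nonempty ι := ⟨x⟩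
    refine ciSup_le fun y => (S.excess_le hP hQ he hf x z y).trans ?_
    have := S.excess_le_maxExcess P Q e f z y
    linarith
  have h1 := key x z
  have h2 := key z x
  rw [S.d_comm z x] at h2
  rw [abs_le]; constructor <;> linarith

/-- Two half-planes violated at `(P x - e v, Q x - f v)`, only one of which has its normal in the
quadrant given by the signs `e` and `f`. -/
lemma sign_false {P Q : ι → ℝ} (hP : S.Admissible P) (hQ : S.swap.Admissible Q) {e f : ℝ}
    (he : e = 1 ∨ e = -1) (hf : f = 1 ∨ f = -1) {x : ι} {v : ℝ} (hv : 0 ≤ v) {y j : ι} (hyp : 0 < e * S.p y) (hyq : 0 < f * S.q y)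
    (hy : S.height x y ≤ S.p y * P x + S.q y * Q x - v * (e * S.p y + f * S.q y))
    (hj : S.height x j < S.p j * (P x - e * v) + S.q j * (Q x - f * v))
    (hjn : ¬ (0 < e * S.p j ∧ 0 < f * S.q j)) : False := by
  have he2 : e * e = 1 := by rcases he with rfl | rfl <;> norm_num
  have hf2 : f * f = 1 := by rcases hf with rfl | rfl <;> norm_num
  have he0 : e ≠ 0 := left_ne_zero_of_mul_eq_one he2
  have hf0 : f ≠ 0 := left_ne_zero_of_mul_eq_one hf2
  have hD : e * S.p y * (f * S.q j) - f * S.q y * (e * S.p j) ≠ 0 → S.det y j ≠ 0 := by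
    intro h h'
    apply h
    have : e * S.p y * (f * S.q j) - f * S.q y * (e * S.p j) = e * f * S.det y j := by
      unfold det; ring
    rw [this, h', mul_zero]
  have hunit : ∀ i, (e * S.p i) ^ 2 + (f * S.q i) ^ 2 = 1 := by
    intro i
    have : (e * S.p i) ^ 2 + (f * S.q i) ^ 2 = e * e * S.p i ^ 2 + f * f * S.q i ^ 2 := by ring
    rw [this, he2, hf2, one_mul, one_mul, S.unit]
  refine quadrant_false (P := e * P x) (Q := f * Q x) (X := S.height x y) (Y := S.height x j)
    hyp hyq (hunit y) (hunit j) hv ?_ ?_ hjn ?_ ?_ ?_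
  · calc _ ≤ _ := hy
      _ = e * e * S.p y * P x + f * f * S.q y * Q x - v * (e * S.p y + f * S.q y) := by
        rw [he2, hf2, one_mul, one_mul]
      _ = _ := by ring
  · calc _ < _ := hj
      _ = e * e * S.p j * P x - e * S.p j * v + (f * f * S.q j * Q x - f * S.q j * v) := by
        rw [he2, hf2, one_mul, one_mul]; ring
      _ = _ := by ring
  · intro s t hs ht h h1 h2
    refine hP x y j s t e hs ht (Or.inl (hD h)) he ?_ ?_
    · calc _ = e * e * (s * S.p y + t * S.p j) := by rw [he2, one_mul]
        _ = e * (s * (e * S.p y) + t * (e * S.p j)) := by ring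
        _ = e := by rw [h2, mul_one]
    · refine (mul_eq_zero.1 (?_ : f * _ = 0)).resolve_left hf0
      rw [← h1]; ring
  · intro s t hs ht h h1 h2
    refine hQ x y j s t f hs ht (Or.inl ?_) hf ?_ ?_
    · intro h'
      apply hD h
      simp only [swap, det] at h' ⊢
      linarith
    · simp only [swap]
      calc _ = f * f * (s * S.q y + t * S.q j) := by rw [hf2, one_mul]
        _ = f * (s * (f * S.q y) + t * (f * S.q j)) := by ring
        _ = f := by rw [h2, mul_one]
    · simp only [swap]
      refine (mul_eq_zero.1 (?_ : e * _ = 0)).resolve_left he0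
      rw [← h1]; ring
  · intro h1 h2
    refine S.height_opposite x ?_ ?_
    · apply mul_left_cancel₀ he0; linarith
    · apply mul_left_cancel₀ hf0; linarith

/-- A violated half-plane has its normal in an open quadrant. -/
lemma exists_signs {P Q : ι → ℝ} (hP : S.Admissible P) (hQ : S.swap.Admissible Q) {x y : ι}
    (hy : S.height x y < S.p y * P x + S.q y * Q x) :
    ∃ e f : ℝ, (e = 1 ∨ e = -1) ∧ (f = 1 ∨ f = -1) ∧ 0 < e * S.p y ∧ 0 < f * S.q y := by
  have hu := S.unit y
  have hp0 : S.p y ≠ 0 := by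
    intro h
    rw [h] at hu hy
    have hq : S.q y = 1 ∨ S.q y = -1 := sq_eq_one_iff.1 (by linarith)
    -- A normal on an axis bounds a coordinate by itself, as a pair whose second weight is zero, so
    -- it cannot be violated.
    have := hQ x y y 1 0 (S.q y) zero_le_one le_rfl (Or.inr rfl) hq (by simp [swap])
      (by simp [swap, h])
    simp only [swap, height] at this hy
    linarith
  have hq0 : S.q y ≠ 0 := by
    intro h
    rw [h] at hu hy
    have hp : S.p y = 1 ∨ S.p y = -1 := sq_eq_one_iff.1 (by linarith)
    have := hP x y y 1 0 (S.p y) zero_le_one le_rfl (Or.inr rfl) hp (by simp) (by simp [h])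
    linarith
  have key : ∀ a : ℝ, a ≠ 0 → ∃ e : ℝ, (e = 1 ∨ e = -1) ∧ 0 < e * a := by
    intro a ha
    rcases ha.lt_or_gt with h | h
    · exact ⟨-1, Or.inr rfl, by linarith⟩
    · exact ⟨1, Or.inl rfl, by linarith⟩
  obtain ⟨e, he, he'⟩ := key _ hp0
  obtain ⟨f, hf, hf'⟩ := key _ hq0
  exact ⟨e, f, he, hf, he', hf'⟩

lemma exists_of_maxExcess_pos [Finite ι] {P Q : ι → ℝ} {e f : ℝ} {x : ι}
    (h : 0 < S.maxExcess P Q e f x) :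
    ∃ y, 0 < e * S.p y ∧ 0 < f * S.q y ∧
      S.p y * P x + S.q y * Q x - S.height x y
        = S.maxExcess P Q e f x * (e * S.p y + f * S.q y) := by
  have : Nonempty ι := ⟨x⟩
  obtain ⟨y, hy⟩ := exists_eq_ciSup_of_finite (f := fun y => S.excess P Q e f x y)
  change S.excess P Q e f x y = S.maxExcess P Q e f x at hy
  rw [← hy] at h ⊢
  unfold excess at h ⊢
  split_ifs at h ⊢ with hs
  · refine ⟨y, hs.1, hs.2, ?_⟩
    have hpos : 0 < e * S.p y + f * S.q y := add_pos hs.1 hs.2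
    rcases max_choice 0 ((S.p y * P x + S.q y * Q x - S.height x y) / (e * S.p y + f * S.q y))
      with h' | h'
    · rw [h'] at h; exact absurd h (lt_irrefl _)
    · rw [h', div_mul_cancel₀ _ hpos.ne']
  · exact absurd h (lt_irrefl _)

lemma le_maxExcess_mul [Finite ι] {P Q : ι → ℝ} {e f : ℝ} {x y : ι} (hp : 0 < e * S.p y)
    (hq : 0 < f * S.q y) :
    S.p y * P x + S.q y * Q x - S.height x y
      ≤ S.maxExcess P Q e f x * (e * S.p y + f * S.q y) := by
  rw [← div_le_iff₀ (add_pos hp hq)]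
  refine le_trans ?_ (S.excess_le_maxExcess P Q e f x y)
  unfold excess
  rw [if_pos ⟨hp, hq⟩]
  exact le_max_right _ _

lemma signs_unique {e f e' f' a b : ℝ} (he : e = 1 ∨ e = -1) (hf : f = 1 ∨ f = -1)
    (he' : e' = 1 ∨ e' = -1) (hf' : f' = 1 ∨ f' = -1) (h1 : 0 < e * a) (h2 : 0 < f * b)
    (h3 : 0 < e' * a) (h4 : 0 < f' * b) : e' = e ∧ f' = f := by
  constructor
  · rcases he with rfl | rfl <;> rcases he' with rfl | rfl <;> first | rfl | (exfalso; linarith)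
  · rcases hf with rfl | rfl <;> rcases hf' with rfl | rfl <;> first | rfl | (exfalso; linarith)

/-- Only half-planes from one quadrant are violated. -/
lemma maxExcess_eq_zero [Finite ι] {P Q : ι → ℝ} (hP : S.Admissible P) (hQ : S.swap.Admissible Q)
    {e f e' f' : ℝ} (he : e = 1 ∨ e = -1) (hf : f = 1 ∨ f = -1) (he' : e' = 1 ∨ e' = -1)
    (hf' : f' = 1 ∨ f' = -1) {x : ι} (h : 0 < S.maxExcess P Q e f x) (hne : ¬ (e' = e ∧ f' = f)) :
    S.maxExcess P Q e' f' x = 0 := by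
  by_contra h0
  obtain ⟨y, hp, hq, hy⟩ := S.exists_of_maxExcess_pos h
  have h' := (S.maxExcess_nonneg P Q e' f' x).lt_of_ne' h0
  obtain ⟨j, hjp, hjq, hj⟩ := S.exists_of_maxExcess_pos h'
  refine S.sign_false hP hQ he hf le_rfl (x := x) hp hq (j := j) ?_ ?_ ?_
  · have := mul_pos h (add_pos hp hq)
    linarith
  · have := mul_pos h' (add_pos hjp hjq)
    simp only [mul_zero, sub_zero]
    linarith
  · rintro ⟨h1, h2⟩
    exact hne (signs_unique he hf he' hf' h1 h2 hjp hjq)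

/-- After the correction the point lies in its own half-plane. -/
lemma corrected_mem [Finite ι] {P Q : ι → ℝ} (hP : S.Admissible P) (hQ : S.swap.Admissible Q)
    {e f : ℝ} (he : e = 1 ∨ e = -1) (hf : f = 1 ∨ f = -1) {x : ι}
    (h : 0 < S.maxExcess P Q e f x) :
    S.p x * (P x - e * S.maxExcess P Q e f x) + S.q x * (Q x - f * S.maxExcess P Q e f x)
      ≤ S.b x := by
  have hb : S.height x x = S.b x := by unfold height; rw [S.d_self]; ring
  rw [← hb]
  by_contra! hcon
  obtain ⟨y, hp, hq, hy⟩ := S.exists_of_maxExcess_pos h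
  -- Inside the quadrant the maximal shift suffices; outside it, a violation would conflict with the
  -- half-plane `y` that attains the maximum, which is tight at the shifted point.
  by_cases hx : 0 < e * S.p x ∧ 0 < f * S.q x
  · have := S.le_maxExcess_mul hx.1 hx.2 (P := P) (Q := Q) (x := x)
    linarith
  · exact S.sign_false hP hQ he hf h.le hp hq (by linarith) hcon hx

lemma mem_of_maxExcess_eq_zero [Finite ι] {P Q : ι → ℝ} (hP : S.Admissible P)
    (hQ : S.swap.Admissible Q) {x : ι}
    (h : ∀ e f : ℝ, (e = 1 ∨ e = -1) → (f = 1 ∨ f = -1) → S.maxExcess P Q e f x = 0) :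
    S.p x * P x + S.q x * Q x ≤ S.b x := by
  have hb : S.height x x = S.b x := by unfold height; rw [S.d_self]; ring
  rw [← hb]
  by_contra! hcon
  obtain ⟨e, f, he, hf, h1, h2⟩ := S.exists_signs hP hQ hcon
  have := S.le_maxExcess_mul h1 h2 (P := P) (Q := Q) (x := x)
  rw [h e f he hf, zero_mul] at this
  linarith

/-- A finite system of half-planes has a Lipschitz selection. -/
theorem exists_selection [Finite ι] :
    ∃ g₁ g₂ : ι → ℝ, (∀ x, S.p x * g₁ x + S.q x * g₂ x ≤ S.b x) ∧
      (∀ x y, |g₁ x - g₁ y| ≤ 648 * S.l * S.d x y) ∧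
      ∀ x y, |g₂ x - g₂ y| ≤ 648 * S.l * S.d x y := by
  obtain ⟨P, hP, hPL⟩ := S.exists_admissible
  obtain ⟨Q, hQ, hQL⟩ := S.swap.exists_admissible
  change ∀ x y, |Q x - Q y| ≤ 72 * S.l * S.d x y at hQL
  have one : (1 : ℝ) = 1 ∨ (1 : ℝ) = -1 := Or.inl rfl
  have neg : (-1 : ℝ) = 1 ∨ (-1 : ℝ) = -1 := Or.inr rfl
  have ne : (1 : ℝ) ≠ -1 := by norm_num
  have ne' : (-1 : ℝ) ≠ 1 := by norm_num
  obtain ⟨E, hE⟩ : ∃ E, E = S.maxExcess P Q := ⟨_, rfl⟩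
  -- At each `x` at most one of the four excesses is nonzero, so the signed sums carry out the right
  -- shift in all cases while being visibly Lipschitz: `648 = 72 + 4 * 144`.
  refine ⟨fun x => P x - (E 1 1 x + E 1 (-1) x - E (-1) 1 x - E (-1) (-1) x),
    fun x => Q x - (E 1 1 x - E 1 (-1) x + E (-1) 1 x - E (-1) (-1) x), fun x => ?_, ?_, ?_⟩
  · beta_reduce
    have zero : ∀ e f e' f' : ℝ, (e = 1 ∨ e = -1) → (f = 1 ∨ f = -1) → (e' = 1 ∨ e' = -1) →
        (f' = 1 ∨ f' = -1) → 0 < E e f x → ¬ (e' = e ∧ f' = f) → E e' f' x = 0 := by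
      rw [hE]; exact fun e f e' f' he hf he' hf' => S.maxExcess_eq_zero hP hQ he hf he' hf'
    have mem : ∀ e f : ℝ, (e = 1 ∨ e = -1) → (f = 1 ∨ f = -1) → 0 < E e f x →
        S.p x * (P x - e * E e f x) + S.q x * (Q x - f * E e f x) ≤ S.b x := by
      rw [hE]; exact fun e f he hf => S.corrected_mem hP hQ he hf
    have nonneg : ∀ e f : ℝ, 0 ≤ E e f x := by
      rw [hE]; exact fun e f => S.maxExcess_nonneg P Q e f x
    by_cases h : ∃ e f : ℝ, (e = 1 ∨ e = -1) ∧ (f = 1 ∨ f = -1) ∧ 0 < E e f x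
    · obtain ⟨e, f, he, hf, h⟩ := h
      have hm := mem e f he hf h
      have hz := fun e' f' he' hf' => zero e f e' f' he hf he' hf' h
      have z1 := hz 1 1 one one
      have z2 := hz 1 (-1) one neg
      have z3 := hz (-1) 1 neg one
      have z4 := hz (-1) (-1) neg neg
      rcases he with rfl | rfl <;> rcases hf with rfl | rfl
      · rw [z2 (by simp [ne']), z3 (by simp [ne']), z4 (by simp [ne'])]; linarith
      · rw [z1 (by simp [ne]), z3 (by simp [ne']), z4 (by simp [ne'])]; linarith
      · rw [z1 (by simp [ne]), z2 (by simp [ne]), z4 (by simp [ne'])]; linarith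
      · rw [z1 (by simp [ne]), z2 (by simp [ne]), z3 (by simp [ne])]; linarith
    · push Not at h
      have hz : ∀ e f : ℝ, (e = 1 ∨ e = -1) → (f = 1 ∨ f = -1) → E e f x = 0 :=
        fun e f he hf => le_antisymm (h e f he hf) (nonneg e f)
      have := S.mem_of_maxExcess_eq_zero hP hQ (x := x) (by rw [← hE]; exact hz)
      rw [hz 1 1 one one, hz 1 (-1) one neg, hz (-1) 1 neg one, hz (-1) (-1) neg neg]
      linarith
  all_goals
    intro x y
    have hL : ∀ e f : ℝ, (e = 1 ∨ e = -1) → (f = 1 ∨ f = -1) →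
        |E e f x - E e f y| ≤ 144 * S.l * S.d x y := by
      rw [hE]; exact fun e f he hf => S.abs_maxExcess_sub_le hPL hQL he hf x y
    obtain ⟨a1, a2⟩ := abs_le.1 (hL 1 1 one one)
    obtain ⟨b1, b2⟩ := abs_le.1 (hL 1 (-1) one neg)
    obtain ⟨c1, c2⟩ := abs_le.1 (hL (-1) 1 neg one)
    obtain ⟨d1, d2⟩ := abs_le.1 (hL (-1) (-1) neg neg)
    obtain ⟨p1, p2⟩ := abs_le.1 (hPL x y)
    obtain ⟨q1, q2⟩ := abs_le.1 (hQL x y)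
    rw [abs_le]
    constructor <;> linarith

end PlanarSystem

/-! ### Passage from half-planes and angles to the dual system. -/

namespace HalfPlaneSelection

lemma mem_halfPlane {n : EuclideanSpace ℝ (Fin 2)} {α : ℝ} {a : Fin 2 → ℝ} :
    a ∈ halfPlane n α ↔ a 0 * n 0 + a 1 * n 1 + α ≤ 0 := Iff.rfl

lemma sq_add_sq_eq_one {n : EuclideanSpace ℝ (Fin 2)} (hn : ‖n‖ = 1) : n 0 ^ 2 + n 1 ^ 2 = 1 := by
  have := EuclideanSpace.real_norm_sq_eq n
  rw [hn, Fin.sum_univ_two] at this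
  linarith

lemma norm_boundaryDirection {n : EuclideanSpace ℝ (Fin 2)} (hn : ‖n‖ = 1) :
    ‖boundaryDirection n‖ = 1 := by
  have h := EuclideanSpace.real_norm_sq_eq (boundaryDirection n)
  rw [Fin.sum_univ_two] at h
  simp only [boundaryDirection, PiLp.toLp_apply, Matrix.cons_val_zero, Matrix.cons_val_one] at h
  have := sq_add_sq_eq_one hn
  rw [← pow_left_inj₀ (norm_nonneg _) zero_le_one two_ne_zero]
  simp only [boundaryDirection]
  rw [h]; linarith

/-- The sine of the angle between two boundary lines is the modulus of the determinant of the unit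
normals. -/
lemma sin_boundaryAngle {n n' : EuclideanSpace ℝ (Fin 2)} (hn : ‖n‖ = 1) (hn' : ‖n'‖ = 1) :
    Real.sin (boundaryAngle n n') = |n 0 * n' 1 - n 1 * n' 0| := by
  have h1 : Real.sin (boundaryAngle n n') =
      Real.sin (InnerProductGeometry.angle (boundaryDirection n) (boundaryDirection n')) := by
    unfold boundaryAngle lineAngle
    rcases min_choice (InnerProductGeometry.angle (boundaryDirection n) (boundaryDirection n'))
      (Real.pi - InnerProductGeometry.angle (boundaryDirection n) (boundaryDirection n'))
      with h | h <;> rw [h]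
    rw [Real.sin_pi_sub]
  have h2 := InnerProductGeometry.sin_angle_mul_norm_mul_norm (boundaryDirection n)
    (boundaryDirection n')
  rw [norm_boundaryDirection hn, norm_boundaryDirection hn', mul_one, mul_one,
    real_inner_self_eq_norm_sq, real_inner_self_eq_norm_sq, norm_boundaryDirection hn,
    norm_boundaryDirection hn'] at h2
  rw [h1, h2, ← Real.sqrt_sq_eq_abs]
  congr 1
  have e : inner ℝ (boundaryDirection n) (boundaryDirection n') = n 0 * n' 0 + n 1 * n' 1 := by
    simp [boundaryDirection, PiLp.inner_apply, Fin.sum_univ_two]; ring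
  rw [e]
  have a := sq_add_sq_eq_one hn
  have b := sq_add_sq_eq_one hn'
  have c : (n 0 ^ 2 + n 1 ^ 2) * (n' 0 ^ 2 + n' 1 ^ 2) = 1 := by rw [a, b, one_mul]
  linarith

lemma halfPlane_inter_nonempty {n n' : EuclideanSpace ℝ (Fin 2)} (α α' : ℝ)
    (h : n 0 * n' 1 - n 1 * n' 0 ≠ 0) : (halfPlane n α ∩ halfPlane n' α').Nonempty := by
  refine ⟨![(n 1 * α' - n' 1 * α) / (n 0 * n' 1 - n 1 * n' 0),
    (n' 0 * α - n 0 * α') / (n 0 * n' 1 - n 1 * n' 0)], mem_halfPlane.2 (le_of_eq ?_),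
    mem_halfPlane.2 (le_of_eq ?_)⟩
  · simp only [Matrix.cons_val_zero, Matrix.cons_val_one]
    rw [div_mul_eq_mul_div, div_mul_eq_mul_div, ← add_div, div_add' _ _ _ h]
    exact div_eq_zero_iff.2 (Or.inl (by ring))
  · simp only [Matrix.cons_val_zero, Matrix.cons_val_one]
    rw [div_mul_eq_mul_div, div_mul_eq_mul_div, ← add_div, div_add' _ _ _ h]
    exact div_eq_zero_iff.2 (Or.inl (by ring))

lemma halfPlane_nonempty {n : EuclideanSpace ℝ (Fin 2)} (hn : ‖n‖ = 1) (α : ℝ) :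
    (halfPlane n α).Nonempty := by
  refine ⟨![-α * n 0, -α * n 1], mem_halfPlane.2 (le_of_eq ?_)⟩
  simp only [Matrix.cons_val_zero, Matrix.cons_val_one]
  linear_combination -α * sq_add_sq_eq_one hn

/-- A bound for the distance of two sets bounds linear functionals on their difference. -/
lemma neg_le_of_setDist_le {A B : Set (Fin 2 → ℝ)} (hA : A.Nonempty) (hB : B.Nonempty)
    {v w V X R : ℝ} (hV : |v| + |w| ≤ V) (hR : 0 ≤ R)
    (hX : ∀ a ∈ A, ∀ b ∈ B, v * (a 0 - b 0) + w * (a 1 - b 1) ≤ X)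
    (h : setDist A B ≤ ENNReal.ofReal R) : -(V * R) ≤ X := by
  have key : ∀ a ∈ A, ∀ b ∈ B, -X ≤ V * dist a b := by
    intro a ha b hb
    have h0 : |a 0 - b 0| ≤ dist a b := dist_le_pi_dist a b 0
    have h1 : |a 1 - b 1| ≤ dist a b := dist_le_pi_dist a b 1
    have e0 : -(v * (a 0 - b 0)) ≤ |v| * dist a b :=
      (neg_le_abs _).trans (by rw [abs_mul]; exact mul_le_mul_of_nonneg_left h0 (abs_nonneg _))
    have e1 : -(w * (a 1 - b 1)) ≤ |w| * dist a b :=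
      (neg_le_abs _).trans (by rw [abs_mul]; exact mul_le_mul_of_nonneg_left h1 (abs_nonneg _))
    have := hX a ha b hb
    have := mul_le_mul_of_nonneg_right hV (dist_nonneg (x := a) (y := b))
    linarith
  have hV0 : 0 ≤ V := (add_nonneg (abs_nonneg v) (abs_nonneg w)).trans hV
  rcases hV0.eq_or_lt with rfl | hV0
  · obtain ⟨a, ha⟩ := hA
    obtain ⟨b, hb⟩ := hB
    have := key a ha b hb
    linarith
  · have h2 : ENNReal.ofReal (-X / V) ≤ setDist A B := by
      unfold setDist
      rw [if_pos ⟨hA, hB⟩]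
      refine le_iInf₂ fun a ha => le_iInf₂ fun b hb => ?_
      rw [edist_dist]
      refine ENNReal.ofReal_le_ofReal ?_
      rw [div_le_iff₀ hV0, mul_comm]
      exact key a ha b hb
    have h3 := (ENNReal.ofReal_le_ofReal_iff hR).1 (h2.trans h)
    rw [div_le_iff₀ hV0] at h3
    linarith

variable {M : Type*} [PseudoEMetricSpace M]

lemma edist_div_eq {x y : M} (hxy : edist x y ≠ ⊤) {D : ℝ} (h : D ≠ 0 ∨ x = y) :
    edist x y / ENNReal.ofReal |D| = ENNReal.ofReal ((edist x y).toReal / |D|) := by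
  rcases eq_or_ne D 0 with hD | hD
  · have : x = y := h.resolve_left (not_not.2 hD)
    subst this
    simp
  · rw [ENNReal.ofReal_div_of_pos (abs_pos.2 hD), ENNReal.ofReal_toReal hxy]

/-- All distances are at most the length of the path `x'`, `x`, `y`, `y'`. -/
lemma ediam_four_le (x x' y y' : M) :
    Metric.ediam {x, x', y, y'} ≤ edist x x' + edist x y + edist y y' := by
  have h1 : edist x y' ≤ edist x y + edist y y' := edist_triangle _ _ _
  have h2 : edist x' y ≤ edist x x' + edist x y := by
    rw [edist_comm x x']; exact edist_triangle _ _ _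
  have h3 : edist x' y' ≤ edist x x' + edist x y + edist y y' :=
    (edist_triangle x' y y').trans (add_le_add h2 le_rfl)
  have g1 : edist x x' ≤ edist x x' + edist x y + edist y y' := by
    rw [add_assoc]; exact le_self_add
  have g2 : edist x y ≤ edist x x' + edist x y + edist y y' := by
    rw [add_right_comm]; exact le_add_self
  have g3 : edist y y' ≤ edist x x' + edist x y + edist y y' := le_add_self
  have g4 : edist x y' ≤ edist x x' + edist x y + edist y y' := by
    rw [add_assoc]; exact h1.trans le_add_self
  have g5 : edist x' y ≤ edist x x' + edist x y + edist y y' := h2.trans le_self_add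
  refine Metric.ediam_le fun a ha b hb => ?_
  simp only [Set.mem_insert_iff, Set.mem_singleton_iff] at ha hb
  rcases ha with rfl | rfl | rfl | rfl <;> rcases hb with rfl | rfl | rfl | rfl <;>
    first
    | (rw [edist_self]; exact bot_le)
    | assumption
    | (rw [edist_comm]; assumption)

variable {n : M → EuclideanSpace ℝ (Fin 2)} {α : M → ℝ} {l : ℝ≥0}

/-- The four-point inequality at points of finite mutual distance, in dual form. -/
def planarSystem {ι : Type*} (z : ι → M) (hn : ∀ x, ‖n x‖ = 1) (hl : FourPointCondition n α l)
    (hz : ∀ i j, edist (z i) (z j) ≠ ⊤) : PlanarSystem ι where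
  d i j := (edist (z i) (z j)).toReal
  p i := n (z i) 0
  q i := n (z i) 1
  b i := -α (z i)
  l := l
  d_self i := by simp
  d_comm i j := by rw [edist_comm]
  d_triangle i j k := by
    rw [← ENNReal.toReal_add (hz i j) (hz j k)]
    exact ENNReal.toReal_mono (ENNReal.add_ne_top.2 ⟨hz i j, hz j k⟩) (edist_triangle _ _ _)
  l_nonneg := l.2
  unit i := sq_add_sq_eq_one (hn _)
  four i j k m hij hkm ci cj ck cm v w V h1 h2 h3 h4 e1 e2 e3 e4 hV := by
    have nonempty : ∀ i j, (n (z i) 0 * n (z j) 1 - n (z i) 1 * n (z j) 0 ≠ 0 ∨ i = j) →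
        (halfPlane (n (z i)) (α (z i)) ∩ halfPlane (n (z j)) (α (z j))).Nonempty := by
      rintro i j (h | rfl)
      · exact halfPlane_inter_nonempty _ _ h
      · rw [Set.inter_self]; exact halfPlane_nonempty (hn _) _
    have hF := hl (z i) (z j) (z k) (z m)
    rw [sin_boundaryAngle (hn _) (hn _), sin_boundaryAngle (hn _) (hn _),
      edist_div_eq (hz i j) (hij.imp_right fun h => by rw [h]),
      edist_div_eq (hz k m) (hkm.imp_right fun h => by rw [h])] at hF
    have hdiam := ediam_four_le (z i) (z j) (z k) (z m)
    rw [← ENNReal.ofReal_toReal (hz i j), ← ENNReal.ofReal_toReal (hz i k),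
      ← ENNReal.ofReal_toReal (hz k m), ← ENNReal.ofReal_add (by positivity) (by positivity),
      ← ENNReal.ofReal_add (by positivity) (by positivity)] at hdiam
    have hF' := hF.trans (mul_le_mul_right (add_le_add le_rfl hdiam) _)
    rw [← ENNReal.ofReal_add (by positivity) (by positivity),
      ← ENNReal.ofReal_add (by positivity) (by positivity), ← ENNReal.ofReal_coe_nnreal,
      ← ENNReal.ofReal_mul (by positivity)] at hF'
    have := neg_le_of_setDist_le (nonempty i j hij) (nonempty k m hkm) hV (by positivity)
      (X := ci * -α (z i) + cj * -α (z j) + ck * -α (z k) + cm * -α (z m)) (by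
        rintro a ⟨ha, ha'⟩ c ⟨hc, hc'⟩
        have f1 := mul_le_mul_of_nonneg_left ha h1
        have f2 := mul_le_mul_of_nonneg_left ha' h2
        have f3 := mul_le_mul_of_nonneg_left hc h3
        have f4 := mul_le_mul_of_nonneg_left hc' h4
        have g1 : v * (a 0 - c 0) = (ci * n (z i) 0 + cj * n (z j) 0) * a 0
            + (ck * n (z k) 0 + cm * n (z m) 0) * c 0 := by rw [e1, e3]; ring
        have g2 : w * (a 1 - c 1) = (ci * n (z i) 1 + cj * n (z j) 1) * a 1
            + (ck * n (z k) 1 + cm * n (z m) 1) * c 1 := by rw [e2, e4]; ring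
        rw [g1, g2]
        linarith) hF'
    refine le_trans (le_of_eq ?_) this
    ring

/-- Lipschitz selections on finite sets of points with finite mutual distances. -/
lemma exists_finset_selection (hn : ∀ x, ‖n x‖ = 1) (hl : FourPointCondition n α l)
    (T : Finset M) (hT : ∀ x ∈ T, ∀ y ∈ T, edist x y ≠ ⊤) :
    ∃ g : M → Fin 2 → ℝ, (∀ x ∈ T, g x ∈ halfPlane (n x) (α x)) ∧
      ∀ x ∈ T, ∀ y ∈ T, edist (g x) (g y) ≤ ((648 * l : ℝ≥0) : ℝ≥0∞) * edist x y := by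
  classical
  obtain ⟨g₁, g₂, h, h₁, h₂⟩ := (planarSystem (ι := T) Subtype.val hn hl
    fun i j => hT i i.2 j j.2).exists_selection
  refine ⟨fun x => if hx : x ∈ T then ![g₁ ⟨x, hx⟩, g₂ ⟨x, hx⟩] else 0, fun x hx => ?_,
    fun x hx y hy => ?_⟩
  · have := h ⟨x, hx⟩
    simp only [planarSystem] at this
    simp only [mem_halfPlane, dif_pos hx, Matrix.cons_val_zero, Matrix.cons_val_one]
    linarith
  · beta_reduce
    rw [dif_pos hx, dif_pos hy, ← ENNReal.ofReal_toReal (hT x hx y hy),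
      ← ENNReal.ofReal_coe_nnreal, ← ENNReal.ofReal_mul (by positivity), edist_dist]
    refine ENNReal.ofReal_le_ofReal ((dist_pi_le_iff (by positivity)).2 fun k => ?_)
    push_cast
    fin_cases k
    · exact h₁ ⟨x, hx⟩ ⟨y, hy⟩
    · exact h₂ ⟨x, hx⟩ ⟨y, hy⟩

/-! ### Compactness and gluing over finite-distance classes. -/

/-- Finitely many half-planes whose normals surround the origin have bounded intersection. -/
lemma isCompact_polygon {ι : Type*} (s : Finset ι) (n : ι → EuclideanSpace ℝ (Fin 2))
    (c : ι → ℝ) (h : (0 : EuclideanSpace ℝ (Fin 2)) ∈ interior (convexHull ℝ (n '' (s : Set ι)))) :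
    IsCompact {a : Fin 2 → ℝ | ∀ i ∈ s, a 0 * n i 0 + a 1 * n i 1 ≤ c i} := by
  refine Metric.isCompact_of_isClosed_isBounded ?_ ?_
  · have : {a : Fin 2 → ℝ | ∀ i ∈ s, a 0 * n i 0 + a 1 * n i 1 ≤ c i}
        = ⋂ i ∈ s, {a : Fin 2 → ℝ | a 0 * n i 0 + a 1 * n i 1 ≤ c i} := by ext; simp
    rw [this]
    exact isClosed_biInter fun i _ => isClosed_le (by fun_prop) (by fun_prop)
  · obtain ⟨ε, hε, hball⟩ := Metric.mem_nhds_iff.1 (mem_interior_iff_mem_nhds.1 h)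
    obtain ⟨C, hC⟩ : ∃ C, C = ∑ i ∈ s, |c i| := ⟨_, rfl⟩
    refine (Metric.isBounded_iff_subset_closedBall 0).2 ⟨2 * C / ε, fun a ha => ?_⟩
    obtain ⟨A, hA⟩ : ∃ A : EuclideanSpace ℝ (Fin 2), A = !₂[a 0, a 1] := ⟨_, rfl⟩
    have hA0 : A 0 = a 0 := by rw [hA]; rfl
    have hA1 : A 1 = a 1 := by rw [hA]; rfl
    have hin : ∀ w : EuclideanSpace ℝ (Fin 2), inner ℝ A w = a 0 * w 0 + a 1 * w 1 := by
      intro w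
      rw [PiLp.inner_apply, Fin.sum_univ_two, hA0, hA1]
      simp [mul_comm]
    have hsub : convexHull ℝ (n '' (s : Set ι)) ⊆ {w | inner ℝ A w ≤ C} := by
      refine convexHull_min ?_ (convex_halfSpace_le
        (IsLinearMap.mk (fun x y => inner_add_right A x y) fun r x => inner_smul_right A x r) C)
      rintro - ⟨i, hi, rfl⟩
      have h1 : |c i| ≤ C := by
        rw [hC]
        exact Finset.single_le_sum (f := fun i => |c i|) (fun _ _ => abs_nonneg _) hi
      have h2 := ha i hi
      change inner ℝ A (n i) ≤ C
      rw [hin]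
      exact (h2.trans (le_abs_self _)).trans h1
    have hC0 : 0 ≤ C := by rw [hC]; exact Finset.sum_nonneg fun _ _ => abs_nonneg _
    have hnorm : ‖A‖ ≤ 2 * C / ε := by
      rcases (norm_nonneg A).eq_or_lt with h0 | h0
      · rw [← h0]; positivity
      -- A functional bounded by `C` at the normals is bounded by `C` on their hull, which contains
      -- the vector of length `ε / 2` in the direction of `A`; hence `ε / 2 * ‖A‖ ≤ C`.
      have hz : (ε / 2 / ‖A‖) • A ∈ Metric.ball (0 : EuclideanSpace ℝ (Fin 2)) ε := by
        rw [mem_ball_zero_iff, norm_smul, Real.norm_of_nonneg (by positivity),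
          div_mul_cancel₀ _ h0.ne']
        linarith
      have h3 : inner ℝ A ((ε / 2 / ‖A‖) • A) ≤ C := hsub (hball hz)
      rw [inner_smul_right, real_inner_self_eq_norm_sq] at h3
      have h4 : ε / 2 / ‖A‖ * ‖A‖ ^ 2 = ε / 2 * ‖A‖ := by field_simp
      rw [h4] at h3
      rw [le_div_iff₀ hε]
      linarith
    rw [mem_closedBall_zero_iff]
    refine (pi_norm_le_iff_of_nonneg (by positivity)).2 fun k => le_trans ?_ hnorm
    fin_cases k
    · change ‖a 0‖ ≤ ‖A‖
      rw [← hA0]; exact PiLp.norm_apply_le A 0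
    · change ‖a 1‖ ≤ ‖A‖
      rw [← hA1]; exact PiLp.norm_apply_le A 1

lemma isClosed_halfPlane (n : EuclideanSpace ℝ (Fin 2)) (α : ℝ) : IsClosed (halfPlane n α) :=
  isClosed_le (by fun_prop) continuous_const

/-- Lipschitz selections on a set of points with finite mutual distances. -/
lemma exists_component_selection (hn : ∀ x, ‖n x‖ = 1) (hl : FourPointCondition n α l)
    (C : Set M) (hC : ∀ x ∈ C, ∀ y ∈ C, edist x y ≠ ⊤)
    (h : C.Finite ∨ ∃ s : Finset M, (s : Set M) ⊆ C ∧
      (0 : EuclideanSpace ℝ (Fin 2)) ∈ interior (convexHull ℝ (n '' (s : Set M)))) :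
    ∃ g : M → Fin 2 → ℝ, (∀ x ∈ C, g x ∈ halfPlane (n x) (α x)) ∧
      ∀ x ∈ C, ∀ y ∈ C, edist (g x) (g y) ≤ ((648 * l : ℝ≥0) : ℝ≥0∞) * edist x y := by
  classical
  rcases h with hfin | ⟨s, hsC, hs⟩
  · simpa using exists_finset_selection hn hl hfin.toFinset (by simpa using hC)
  -- Adding `s` to every finite set confines the values of all the finite selections at a given
  -- point to one compact polygon.
  have hfs : ∀ T : Finset C, ∃ g : M → Fin 2 → ℝ,
      (∀ x ∈ T.image Subtype.val ∪ s, g x ∈ halfPlane (n x) (α x)) ∧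
      ∀ x ∈ T.image Subtype.val ∪ s, ∀ y ∈ T.image Subtype.val ∪ s,
        edist (g x) (g y) ≤ ((648 * l : ℝ≥0) : ℝ≥0∞) * edist x y := by
    intro T
    have : ∀ x ∈ T.image Subtype.val ∪ s, x ∈ C := by
      intro x hx
      rcases Finset.mem_union.1 hx with hx | hx
      · obtain ⟨y, -, rfl⟩ := Finset.mem_image.1 hx
        exact y.2
      · exact hsC hx
    exact exists_finset_selection hn hl _ fun x hx y hy => hC x (this x hx) y (this y hy)
  choose g hg hgL using hfs
  obtain ⟨U, hU⟩ : ∃ U : Ultrafilter (Finset C), U = Ultrafilter.of Filter.atTop := ⟨_, rfl⟩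
  have hev : ∀ x : C, ∀ᶠ T in (U : Filter (Finset C)), x.1 ∈ T.image Subtype.val ∪ s := by
    intro x
    have : ∀ᶠ T : Finset C in Filter.atTop, x.1 ∈ T.image Subtype.val ∪ s := by
      filter_upwards [Filter.eventually_ge_atTop {x}] with T hT
      exact Finset.mem_union_left _
        (Finset.mem_image_of_mem _ (hT (Finset.mem_singleton_self x)))
    rw [hU]
    exact Ultrafilter.of_le _ this
  have hlim : ∀ x : C, ∃ a, Filter.Tendsto (fun T => g T x) U (nhds a) := by
    intro x
    -- The values at `x` and at `i` differ by at most `648 * l * edist x i` in each of two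
    -- coordinates, and the entries of a normal are at most 1 in modulus: hence the factor 2.
    have hK := isCompact_polygon s n
      (fun i => -α i + 2 * (648 * l * (edist x.1 i).toReal)) hs
    obtain ⟨a, -, ha⟩ := hK.ultrafilter_le_nhds (U.map fun T => g T x) (by
      rw [Filter.le_principal_iff, Ultrafilter.coe_map, Filter.mem_map]
      filter_upwards [hev x] with T hT
      intro i hi
      have hiT : i ∈ T.image Subtype.val ∪ s := Finset.mem_union_right _ hi
      have h1 := mem_halfPlane.1 (hg T i hiT)
      have h2 := hgL T x.1 hT i hiT
      have hfin := hC x.1 x.2 i (hsC hi)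
      rw [← ENNReal.ofReal_toReal hfin, ← ENNReal.ofReal_coe_nnreal,
        ← ENNReal.ofReal_mul (by positivity), edist_dist,
        ENNReal.ofReal_le_ofReal_iff (by positivity)] at h2
      push_cast at h2
      have h3 : |g T x.1 0 - g T i 0| ≤ 648 * l * (edist x.1 i).toReal :=
        (dist_le_pi_dist (g T x.1) (g T i) 0).trans h2
      have h4 : |g T x.1 1 - g T i 1| ≤ 648 * l * (edist x.1 i).toReal :=
        (dist_le_pi_dist (g T x.1) (g T i) 1).trans h2
      have bound : ∀ u v R : ℝ, |u| ≤ R → |v| ≤ 1 → u * v ≤ R := by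
        intro u v R hu hv
        calc u * v ≤ |u * v| := le_abs_self _
          _ = |u| * |v| := abs_mul _ _
          _ ≤ R * 1 := mul_le_mul hu hv (abs_nonneg _) ((abs_nonneg _).trans hu)
          _ = R := mul_one R
      have h5 := bound _ (n i 0) _ h3 (by have := PiLp.norm_apply_le (n i) 0; rwa [hn] at this)
      have h6 := bound _ (n i 1) _ h4 (by have := PiLp.norm_apply_le (n i) 1; rwa [hn] at this)
      change g T x.1 0 * n i 0 + g T x.1 1 * n i 1 ≤ _
      linarith)
    exact ⟨a, ha⟩
  choose a ha using hlim
  refine ⟨fun x => if hx : x ∈ C then a ⟨x, hx⟩ else 0, fun x hx => ?_, fun x hx y hy => ?_⟩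
  · beta_reduce
    rw [dif_pos hx]
    refine (isClosed_halfPlane _ _).mem_of_tendsto (ha ⟨x, hx⟩) ?_
    filter_upwards [hev ⟨x, hx⟩] with T hT
    exact hg T x hT
  · beta_reduce
    rw [dif_pos hx, dif_pos hy]
    refine le_of_tendsto ((ha ⟨x, hx⟩).edist (ha ⟨y, hy⟩)) ?_
    filter_upwards [hev ⟨x, hx⟩, hev ⟨y, hy⟩] with T hT hT'
    exact hgL T x hT y hT'

/-- The four-point inequality implies the existence of a Lipschitz selection. -/
theorem exists_selection_of_fourPoint (hn : ∀ x, ‖n x‖ = 1)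
    (h : ∀ x : M, {y : M | edist x y ≠ ⊤}.Finite ∨
      ∃ s : Finset M, (∀ z ∈ s, edist x z ≠ ⊤) ∧
        (0 : EuclideanSpace ℝ (Fin 2)) ∈ interior (convexHull ℝ (n '' (s : Set M))))
    (hl0 : 0 < l) (hl : FourPointCondition n α l) :
    ∃ f : M → Fin 2 → ℝ, (∀ x, f x ∈ halfPlane (n x) (α x)) ∧ LipschitzWith (648 * l) f := by
  have hG : ∀ x₀ : M, ∃ g : M → Fin 2 → ℝ,
      (∀ x, edist x₀ x ≠ ⊤ → g x ∈ halfPlane (n x) (α x)) ∧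
      ∀ x, edist x₀ x ≠ ⊤ → ∀ y, edist x₀ y ≠ ⊤ →
        edist (g x) (g y) ≤ ((648 * l : ℝ≥0) : ℝ≥0∞) * edist x y := by
    intro x₀
    refine exists_component_selection hn hl {x | edist x₀ x ≠ ⊤} (fun x hx y hy => ?_) (h x₀)
    refine ne_top_of_le_ne_top (ENNReal.add_ne_top.2 ⟨?_, hy⟩) (edist_triangle x x₀ y)
    rw [edist_comm]; exact hx
  choose G hG hGL using hG
  -- One representative per class, so that two points at finite distance use the same selection `G`.
  let rep : M → M := fun x => (Quotient.mk Metric.edistLtTopSetoid x).out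
  have hrep : ∀ x, edist (rep x) x ≠ ⊤ := fun x =>
    (Quotient.exact (s := Metric.edistLtTopSetoid) (Quotient.out_eq (Quotient.mk Metric.edistLtTopSetoid x))).ne
  refine ⟨fun x => G (rep x) x, fun x => hG _ _ (hrep x), fun x y => ?_⟩
  by_cases hxy : edist x y = ⊤
  · rw [hxy, ENNReal.mul_top (by simpa using hl0.ne')]
    exact le_top
  · have : rep x = rep y := by
      change (Quotient.mk Metric.edistLtTopSetoid x).out = (Quotient.mk Metric.edistLtTopSetoid y).out
      rw [Quotient.sound (s := Metric.edistLtTopSetoid) (lt_top_iff_ne_top.2 hxy)]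
    beta_reduce
    rw [this]
    exact hGL _ x (this ▸ hrep x) y (hrep y)

/-! ### Necessity of the four-point inequality. -/

/-- A point of a half-plane close to a second half-plane is close to the intersection. -/
lemma exists_mem_inter_near {n n' : EuclideanSpace ℝ (Fin 2)} (hn : ‖n‖ = 1) (hn' : ‖n'‖ = 1)
    {α α' δ : ℝ} {a a' : Fin 2 → ℝ} (ha : a ∈ halfPlane n α) (ha' : a' ∈ halfPlane n' α')
    (hδ : dist a a' ≤ δ) (hD : n 0 * n' 1 - n 1 * n' 0 ≠ 0) :
    ∃ c ∈ halfPlane n α ∩ halfPlane n' α', dist a c ≤ √2 * (δ / |n 0 * n' 1 - n 1 * n' 0|) := by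
  obtain ⟨D, hDdef⟩ : ∃ D, D = n 0 * n' 1 - n 1 * n' 0 := ⟨_, rfl⟩
  rw [← hDdef] at hD ⊢
  obtain ⟨e, he⟩ : ∃ e, e = max 0 (a 0 * n' 0 + a 1 * n' 1 + α') := ⟨_, rfl⟩
  have he0 : 0 ≤ e := he ▸ le_max_left _ _
  have he1 : a 0 * n' 0 + a 1 * n' 1 + α' ≤ e := he ▸ le_max_right _ _
  have hδ0 : 0 ≤ δ := dist_nonneg.trans hδ
  have h0 : |a 0 - a' 0| ≤ δ := (dist_le_pi_dist a a' 0).trans hδ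
  have h1 : |a 1 - a' 1| ≤ δ := (dist_le_pi_dist a a' 1).trans hδ
  have hsum : |n' 0| + |n' 1| ≤ √2 := by
    apply Real.le_sqrt_of_sq_le
    have := sq_add_sq_eq_one hn'
    rw [← sq_abs (n' 0), ← sq_abs (n' 1)] at this
    nlinarith [sq_nonneg (|n' 0| - |n' 1|)]
  have he2 : e ≤ √2 * δ := by
    rw [he]
    refine max_le (by positivity) ?_
    have e0 : (a 0 - a' 0) * n' 0 ≤ δ * |n' 0| :=
      (le_abs_self _).trans (by rw [abs_mul]; exact mul_le_mul_of_nonneg_right h0 (abs_nonneg _))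
    have e1 : (a 1 - a' 1) * n' 1 ≤ δ * |n' 1| :=
      (le_abs_self _).trans (by rw [abs_mul]; exact mul_le_mul_of_nonneg_right h1 (abs_nonneg _))
    have := mem_halfPlane.1 ha'
    have := mul_le_mul_of_nonneg_right hsum hδ0
    linarith
  have habs : ∀ k, |n k| ≤ 1 := fun k => by
    have := PiLp.norm_apply_le n k; rwa [hn] at this
  have hstep : |e / D| ≤ √2 * (δ / |D|) := by
    rw [abs_div, abs_of_nonneg he0, ← mul_div_assoc]
    gcongr
  -- Moving along the boundary direction keeps the value of `n` at the point and lowers that of `n'`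
  -- by exactly `e`.
  refine ⟨![a 0 + e / D * n 1, a 1 - e / D * n 0], ⟨mem_halfPlane.2 ?_, mem_halfPlane.2 ?_⟩, ?_⟩
  · have := mem_halfPlane.1 ha
    simp only [Matrix.cons_val_zero, Matrix.cons_val_one]
    linarith
  · simp only [Matrix.cons_val_zero, Matrix.cons_val_one]
    have : e / D * D = e := div_mul_cancel₀ _ hD
    rw [hDdef] at this ⊢
    linarith
  · refine (dist_pi_le_iff (by positivity)).2 fun k => ?_
    refine le_trans ?_ hstep
    rw [Real.dist_eq]
    fin_cases k
    · change |a 0 - (a 0 + e / D * n 1)| ≤ _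
      rw [sub_add_cancel_left, abs_neg, abs_mul]
      exact mul_le_of_le_one_right (abs_nonneg _) (habs 1)
    · change |a 1 - (a 1 - e / D * n 0)| ≤ _
      rw [sub_sub_cancel, abs_mul]
      exact mul_le_of_le_one_right (abs_nonneg _) (habs 0)

variable {K : ℝ≥0}

/-- If the quotient is infinite, any point of the intersection serves. Parallel boundaries with
finite quotient force distance zero, hence `f x = f x'`, and the point `f x` itself lies in the
intersection. -/
lemma exists_mem_inter_edist_le (hn : ∀ x, ‖n x‖ = 1) {f : M → Fin 2 → ℝ}
    (hf : ∀ x, f x ∈ halfPlane (n x) (α x)) (hK : 0 < K) (hL : LipschitzWith K f) {x x' : M}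
    (hne : (halfPlane (n x) (α x) ∩ halfPlane (n x') (α x')).Nonempty) :
    ∃ c ∈ halfPlane (n x) (α x) ∩ halfPlane (n x') (α x'), edist (f x) c ≤
      ((NNReal.sqrt 2 * K : ℝ≥0) : ℝ≥0∞) *
        (edist x x' / ENNReal.ofReal (Real.sin (boundaryAngle (n x) (n x')))) := by
  rw [sin_boundaryAngle (hn x) (hn x')]
  have hc0 : ((NNReal.sqrt 2 * K : ℝ≥0) : ℝ≥0∞) ≠ 0 := by
    simpa using hK.ne'
  have htop : edist x x' / ENNReal.ofReal |n x 0 * n x' 1 - n x 1 * n x' 0| = ⊤ →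
      ∃ c ∈ halfPlane (n x) (α x) ∩ halfPlane (n x') (α x'), edist (f x) c ≤
      ((NNReal.sqrt 2 * K : ℝ≥0) : ℝ≥0∞) *
        (edist x x' / ENNReal.ofReal |n x 0 * n x' 1 - n x 1 * n x' 0|) := by
    intro h
    obtain ⟨c, hc⟩ := hne
    exact ⟨c, hc, by rw [h, ENNReal.mul_top hc0]; exact le_top⟩
  by_cases hxx : edist x x' = ⊤
  · exact htop (by rw [hxx, ENNReal.top_div_of_ne_top ENNReal.ofReal_ne_top])
  by_cases hD : n x 0 * n x' 1 - n x 1 * n x' 0 = 0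
  · by_cases h0 : edist x x' = 0
    · have h1 : edist (f x) (f x') ≤ 0 := by
        have := hL x x'; rwa [h0, mul_zero] at this
      have h2 : f x = f x' := edist_le_zero.1 h1
      exact ⟨f x, ⟨hf x, h2 ▸ hf x'⟩, by rw [edist_self]; exact bot_le⟩
    · exact htop (by rw [hD, abs_zero, ENNReal.ofReal_zero, ENNReal.div_zero h0])
  · have h1 : dist (f x) (f x') ≤ K * (edist x x').toReal := by
      have := hL x x'
      rwa [← ENNReal.ofReal_toReal hxx, ← ENNReal.ofReal_coe_nnreal,
        ← ENNReal.ofReal_mul (by positivity), edist_dist,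
        ENNReal.ofReal_le_ofReal_iff (by positivity)] at this
    obtain ⟨c, hc, hac⟩ := exists_mem_inter_near (hn x) (hn x') (hf x) (hf x') h1 hD
    refine ⟨c, hc, ?_⟩
    rw [edist_div_eq hxx (Or.inl hD), ← ENNReal.ofReal_coe_nnreal,
      ← ENNReal.ofReal_mul (by positivity), edist_dist]
    refine ENNReal.ofReal_le_ofReal (hac.trans (le_of_eq ?_))
    push_cast
    ring

/-- The four-point inequality is necessary for the existence of a Lipschitz selection. -/
theorem fourPoint_of_selection (hn : ∀ x, ‖n x‖ = 1) {f : M → Fin 2 → ℝ}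
    (hf : ∀ x, f x ∈ halfPlane (n x) (α x)) (hK : 0 < K) (hL : LipschitzWith K f) :
    FourPointCondition n α (NNReal.sqrt 2 * K) := by
  intro x x' y y'
  unfold setDist
  split_ifs with h
  · obtain ⟨c, hc, hxc⟩ := exists_mem_inter_edist_le hn hf hK hL h.1
    obtain ⟨c', hc', hyc⟩ := exists_mem_inter_edist_le hn hf hK hL h.2
    refine (iInf₂_le_of_le c hc (iInf₂_le c' hc')).trans ?_
    have hK' : K ≤ NNReal.sqrt 2 * K :=
      le_mul_of_one_le_left K.2 (by rw [NNReal.le_sqrt_iff_sq_le]; norm_num)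
    have hxy : edist (f x) (f y) ≤
        ((NNReal.sqrt 2 * K : ℝ≥0) : ℝ≥0∞) * Metric.ediam {x, x', y, y'} :=
      (hL x y).trans (mul_le_mul' (ENNReal.coe_le_coe.2 hK')
        (Metric.edist_le_ediam_of_mem (by simp) (by simp)))
    calc edist c c' ≤ edist c (f x) + edist (f x) (f y) + edist (f y) c' :=
        edist_triangle4 _ _ _ _
      _ ≤ _ := add_le_add (add_le_add ((edist_comm _ _).trans_le hxc) hxy) hyc
      _ = _ := by ring
  · exact bot_le

end HalfPlaneSelection

/-! ### The theorem, with `γ = 648`. -/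

theorem mainTheorem3 :
    ∃ γ : ℝ≥0, 0 < γ ∧ γ ≤ 5 * 10 ^ 5 ∧
      ∀ (M : Type*) [PseudoEMetricSpace M]
        (n : M → EuclideanSpace ℝ (Fin 2)) (α : M → ℝ),
        (∀ x, ‖n x‖ = 1) →
        (∀ x : M, {y : M | edist x y ≠ ⊤}.Finite ∨
          ∃ s : Finset M, (∀ z ∈ s, edist x z ≠ ⊤) ∧
            (0 : EuclideanSpace ℝ (Fin 2)) ∈ interior (convexHull ℝ (n '' (s : Set M)))) →
        ((∃ f : M → Fin 2 → ℝ,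
            HalfPlaneSelection.IsLipschitzSelection
              (fun x => HalfPlaneSelection.halfPlane (n x) (α x)) f) ↔
          ∃ l : ℝ≥0, 0 < l ∧ HalfPlaneSelection.FourPointCondition n α l) ∧
        ENNReal.ofReal (1 / √2) * HalfPlaneSelection.fourPointInf n α ≤
          HalfPlaneSelection.selectionNorm
            (fun x => HalfPlaneSelection.halfPlane (n x) (α x)) ∧
        HalfPlaneSelection.selectionNorm
            (fun x => HalfPlaneSelection.halfPlane (n x) (α x)) ≤
          (γ : ℝ≥0∞) * HalfPlaneSelection.fourPointInf n α := by
  refine ⟨648, by norm_num, by norm_num, fun M _ n α hn h => ⟨⟨?_, ?_⟩, ?_, ?_⟩⟩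
  · rintro ⟨f, hf, K, hK⟩
    -- The Lipschitz constant of a selection may be zero, while the constant in the four-point
    -- inequality has to be positive.
    have hK' : LipschitzWith (K + 1) f := hK.weaken le_self_add
    exact ⟨NNReal.sqrt 2 * (K + 1), by positivity,
      HalfPlaneSelection.fourPoint_of_selection hn hf (by positivity) hK'⟩
  · rintro ⟨l, hl0, hl⟩
    obtain ⟨f, hf, hfL⟩ := HalfPlaneSelection.exists_selection_of_fourPoint hn h hl0 hl
    exact ⟨f, hf, _, hfL⟩
  · refine le_iInf₂ fun f hf => le_iInf₂ fun K hK => ?_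
    have h1 : HalfPlaneSelection.fourPointInf n α ≤ ((NNReal.sqrt 2 * K : ℝ≥0) : ℝ≥0∞) :=
      iInf₂_le _ ⟨mul_pos (by positivity) hK.1, HalfPlaneSelection.fourPoint_of_selection hn hf.1 hK.1 hK.2⟩
    refine (mul_le_mul_right h1 _).trans (le_of_eq ?_)
    rw [← ENNReal.ofReal_coe_nnreal, ← ENNReal.ofReal_mul (by positivity),
      ← ENNReal.ofReal_coe_nnreal]
    congr 1
    push_cast
    field_simp
  · unfold HalfPlaneSelection.fourPointInf
    rw [ENNReal.mul_iInf_of_ne (by norm_num) ENNReal.coe_ne_top]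
    refine le_iInf fun l => ?_
    rw [ENNReal.mul_iInf_of_ne (by norm_num) ENNReal.coe_ne_top]
    refine le_iInf fun hl => ?_
    obtain ⟨f, hf, hfL⟩ := HalfPlaneSelection.exists_selection_of_fourPoint hn h hl.1 hl.2
    refine (iInf₂_le f ⟨hf, _, hfL⟩).trans ?_
    refine (iInf₂_le (648 * l) ⟨mul_pos (by norm_num) hl.1, hfL⟩).trans (le_of_eq ?_)
    push_cast
    rfl
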